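/- Notation. $\mathbb R^d$ carries the Euclidean norm $\|\cdot\|$; $\|B\|$ is the induced operator norm of $B\in\mathbb R^{n\times d}$. For a proper function $p:\mathbb R^m\to\mathbb R\cup\{+\infty\}$ and $\gamma>0$ let $\mathrm{prox}_{\gamma p}(v)=\arg\min_w\{p(w)+\frac1{2\gamma}\|w-v\|^2\}$ (a set, identified with its element when it is a singleton), $\mathrm{env}_\gamma p(v)=\inf_w\{p(w)+\frac1{2\gamma}\|w-v\|^2\}$ and $p^*(y)=\sup_x\{\langle y,x\rangle-p(x)\}$. Let $\mathrm{proj}_C$ be the Euclidean projection onto $C$, and let $\iota_C$ be $0$ on $C$ and $+\infty$ off $C$. A proper lower semicontinuous $\varphi:\mathbb R^n\to\mathbb R\cup\{+\infty\}$ is called sparsity promoting if $\varphi(0)=0=\min\varphi$ and its Fréchet subdifferential at $0$ contains a nonzero element. Theorem. Let $\varphi$ be a convex sparsity promoting function on $\mathbb R^n$, $\alpha>0$ and $\varphi_\alpha=\varphi-\mathrm{env}_\alpha\varphi$. Let $C\subseteq\mathbb R^d$ be closed and convex, $z\in\mathbb R^d$, $B\in\mathbb R^{n\times d}$, $\lambda>0$,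 and suppose that $\varphi(Bx)<+\infty$ for at least one $x\in C$. Consider the problem $$(\mathcal P)\qquad \text{minimize } \tfrac1{2\lambda}\|x-z\|^2+\varphi_\alpha(Bx)\ \text{ over } x\in C,$$ and, for $\tau,\sigma,\rho>0$ and arbitrary $x^{(0)}\in\mathbb R^d$, $y^{(0)}\in\mathbb R^n$, Algorithm 1: $$\tilde x^{(k+1)}=\mathrm{proj}_C\Big(x^{(k)}-\tfrac{\tau}{\lambda}(x^{(k)}-z)+\tau B^\top\big(\mathrm{prox}_{\alpha^{-1}\varphi^*}(\alpha^{-1}Bx^{(k)})-y^{(k)}\big)\Big),$$ $$\tilde y^{(k+1)}=\mathrm{prox}_{\sigma\varphi^*}\big(y^{(k)}+\sigma B(2\tilde x^{(k+1)}-x^{(k)})\big),$$ $$(x^{(k+1)},y^{(k+1)})=\rho(\tilde x^{(k+1)},\tilde y^{(k+1)})+(1-\rho)(x^{(k)},y^{(k)}).$$ Suppose that $\lambda\|B\|^2<\alpha$, that (i) $\frac1\tau-\sigma\|B\|^2>\frac1{2\lambda}$, and that (ii) $\rho\in(0,1]$. Then: (a) the function $F(x)=\frac1{2\lambda}\|x-z\|^2-\mathrm{env}_\alpha\varphi(Bx)$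 is differentiable, and with $G=\iota_C$, $H=\varphi$ a sequence $(x^{(k)},y^{(k)})_{k\ge0}$ is produced by Algorithm 1 if and only if it is produced by Condat's primal–dual splitting $$\tilde x^{(k+1)}=\mathrm{prox}_{\tau G}\big(x^{(k)}-\tau\nabla F(x^{(k)})-\tau B^\top y^{(k)}\big),\qquad \tilde y^{(k+1)}=\mathrm{prox}_{\sigma H^*}\big(y^{(k)}+\sigma B(2\tilde x^{(k+1)}-x^{(k)})\big),$$ followed by the same relaxation step; (b) for all initial points $(x^{(0)},y^{(0)})$, Algorithm 1 can be carried out (all its steps are well defined); (c) for every sequence $(x^{(k)},y^{(k)})_{k\ge0}$ produced by Algorithm 1, $x^{(k)}$ converges to a solution of $(\mathcal P)$. -/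

import Mathlib

open Filter Topology

noncomputable section

namespace StructuredSPF

/-- `d`-dimensional Euclidean space. -/
abbrev E (d : ℕ) : Type := EuclideanSpace ℝ (Fin d)

/-- Proper lower semicontinuous functions with values in `ℝ ∪ {+∞}`, modelled as `EReal`-valued
functions that never take the value `-∞`. -/
structure IsGamma {d : ℕ} (p : E d → EReal) : Prop where
  ne_bot : ∀ x, p x ≠ ⊥
  proper : ∃ x, p x ≠ ⊤
  lsc : LowerSemicontinuous p

/-- Convexity of an extended-real-valued function: its epigraph is a convex set. -/
def IsConvexFun {d : ℕ} (p : E d → EReal) : Prop :=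
  Convex ℝ {q : E d × ℝ | p q.1 ≤ (q.2 : EReal)}

/-- The Fréchet subdifferential of `p` at `z` (empty where `p z = +∞`). -/
def frechetSubdiff {d : ℕ} (p : E d → EReal) (z : E d) : Set (E d) :=
  {t | p z ≠ ⊤ ∧
    0 ≤ liminf (fun u : E d =>
      (p u - p z - ((inner ℝ t (u - z) : ℝ) : EReal)) / ((‖u - z‖ : ℝ) : EReal)) (𝓝[≠] z)}

/-- Sparsity promoting functions: proper, lower semicontinuous, with global minimum zero attained
at the origin, and with a nonzero Fréchet subgradient at the origin. -/
structure IsSPF {d : ℕ} (φ : E d → EReal) : Prop where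
  gamma : IsGamma φ
  map_zero : φ 0 = 0
  nonneg : ∀ x, 0 ≤ φ x
  exists_subgradient : ∃ t ∈ frechetSubdiff φ 0, t ≠ 0

/-- The (set-valued) proximity operator `prox_{α p}` at `v`, that is, the set of minimizers of
`w ↦ p w + ‖w - v‖² / (2 α)`. -/
def prox {d : ℕ} (α : ℝ) (p : E d → EReal) (v : E d) : Set (E d) :=
  {w | IsMinOn (fun u : E d => p u + ((1 / (2 * α) * ‖u - v‖ ^ 2 : ℝ) : EReal)) Set.univ w}

/-- The Moreau envelope `env_α p`. -/
def env {d : ℕ} (α : ℝ) (p : E d → EReal) (v : E d) : EReal :=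
  ⨅ w : E d, p w + ((1 / (2 * α) * ‖w - v‖ ^ 2 : ℝ) : EReal)

/-- The Fenchel conjugate `p^*`. -/
def conj {d : ℕ} (p : E d → EReal) (y : E d) : EReal :=
  ⨆ x : E d, ((inner ℝ y x : ℝ) : EReal) - p x

/-- The structured sparsity promoting function `φ_α = φ - env_α φ`. -/
def structured {d : ℕ} (α : ℝ) (φ : E d → EReal) (x : E d) : EReal :=
  φ x - env α φ x

open Classical in
/-- The indicator function `ι_C`: zero on `C` and `+∞` off `C`. -/
def indic {d : ℕ} (C : Set (E d)) (x : E d) : EReal :=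
  if x ∈ C then 0 else ⊤

/-- The (set-valued) projection: the points of `C` nearest to `v`. -/
def proj {d : ℕ} (C : Set (E d)) (v : E d) : Set (E d) :=
  {w | w ∈ C ∧ ∀ u ∈ C, ‖w - v‖ ≤ ‖u - v‖}

/-- The objective function `x ↦ ‖x - z‖² / (2 λ) + φ_α (B x)`. -/
def objective {d n : ℕ} (φ : E n → EReal) (α lam : ℝ) (B : E d →L[ℝ] E n) (z : E d) (x : E d) :
    EReal :=
  ((1 / (2 * lam) * ‖x - z‖ ^ 2 : ℝ) : EReal) + structured α φ (B x)

/-- `x` minimizes `‖x - z‖² / (2 λ) + φ_α (B x)` over `C`. -/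
def IsSolution {d n : ℕ} (φ : E n → EReal) (C : Set (E d)) (α lam : ℝ) (B : E d →L[ℝ] E n)
    (z : E d) (x : E d) : Prop :=
  x ∈ C ∧ IsMinOn (objective φ α lam B z) C x

/-- The smooth part `F x = ‖x - z‖² / (2 λ) - env_α φ (B x)`; for `φ` nonnegative with `φ 0 = 0`
and `α > 0` the envelope has finite values, so that `toReal` loses nothing. -/
def smoothPart {d n : ℕ} (φ : E n → EReal) (α lam : ℝ) (B : E d →L[ℝ] E n) (z : E d) (x : E d) :
    ℝ :=
  1 / (2 * lam) * ‖x - z‖ ^ 2 - (env α φ (B x)).toReal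

/-- `(x, y)` is a sequence of iterates of the (relaxed) Condat primal-dual splitting for
minimizing `F x + G x + H (B x)`. -/
def IsCondatRun {d n : ℕ} (F : E d → ℝ) (G : E d → EReal) (H : E n → EReal) (B : E d →L[ℝ] E n)
    (τ σ ρ : ℝ) (x : ℕ → E d) (y : ℕ → E n) : Prop :=
  ∀ k, ∃ (xt : E d) (yt : E n),
    xt ∈ prox τ G (x k - τ • gradient F (x k) - τ • B.adjoint (y k)) ∧
    yt ∈ prox σ (conj H) (y k + σ • B ((2 : ℝ) • xt - x k)) ∧
    x (k + 1) = ρ • xt + (1 - ρ) • x k ∧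
    y (k + 1) = ρ • yt + (1 - ρ) • y k

/-- `(x, y)` is a sequence of iterates of the primal-dual splitting algorithm for minimizing
`‖x - z‖² / (2 λ) + φ_α (B x)` over `C`. -/
def IsPDRun {d n : ℕ} (φ : E n → EReal) (C : Set (E d)) (α lam : ℝ) (B : E d →L[ℝ] E n) (z : E d)
    (τ σ ρ : ℝ) (x : ℕ → E d) (y : ℕ → E n) : Prop :=
  ∀ k, ∃ (xt : E d) (yt : E n) (q : E n),
    q ∈ prox α⁻¹ (conj φ) (α⁻¹ • B (x k)) ∧
    xt ∈ proj C (x k - τ • ((1 / lam) • (x k - z)) + τ • B.adjoint (q - y k)) ∧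
    yt ∈ prox σ (conj φ) (y k + σ • B ((2 : ℝ) • xt - x k)) ∧
    x (k + 1) = ρ • xt + (1 - ρ) • x k ∧
    y (k + 1) = ρ • yt + (1 - ρ) • y k

end StructuredSPF

end

/-! ### Real sequences with summable errors -/

section RealSequences

/-! By Moreau's decomposition, the dual prox in the algorithm is the gradient of `env α φ` at `B x`,
so the algorithm is Condat's splitting (`isPDRun_iff_isCondatRun`). Subtracting the convex envelope
preserves the smoothness constant L = 1/λ of the quadratic and leaves strong convexity of modulus μ
= 1/λ - ‖B‖²/α > 0 (`hasQuadraticBounds_smoothPart`).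

No qualification condition links C to the domain of φ ∘ B, so a saddle point need not exist and the
usual Fejér argument is not available. What survives is the absence of a duality gap: penalized
problems yield a primal minimizer xs, of value p, and dual points of value at least p - ε
(`exists_solution_and_dual`).

Convergence is `tendsto_of_isPrimalDualStep`. Comparing two consecutive steps, the displacement
decreases in the primal-dual metric, by enough to make ‖xt - x‖² summable (`pdForm_succ_le`). Tested
against ε-optimal dual points, the gap estimate `gap_le` makes the Cesàro means of the squared
displacement small, so by monotonicity the displacement vanishes. The Lagrangian at the iterates
increases up to vanishing and summable corrections (`lagrangian_succ_ge`) and is at most p - μ/4 ‖x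
- xs‖² + o(1) (`lagrangian_add_le`), so it has a limit l. If l < p, some dual point of value above l
would attract the dual iterates by a fixed amount of squared distance at each late step, up to a
summable relative error, which is impossible (`le_of_tendsto_lagrangian`). Hence l ≥ p, and the term
μ/4 ‖x - xs‖² is squeezed to zero. -/

lemma tendsto_of_le_add_summable {V s : ℕ → ℝ} {M : ℝ} (hs0 : ∀ k, 0 ≤ s k) (hs : Summable s)
    (hV : ∀ k, V k ≤ V (k + 1) + s k) (hM : ∀ k, V k ≤ M) :
    ∃ l, Tendsto V atTop (𝓝 l) := by
  set S : ℕ → ℝ := fun k => ∑ j ∈ Finset.range k, s j with hS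
  -- Adding the accumulated errors compensates every possible drop of V.
  have hmono : Monotone fun k => V k + S k := by
    refine monotone_nat_of_le_succ fun k => ?_
    simp only [hS, Finset.sum_range_succ]
    linarith [hV k]
  have hbdd : BddAbove (Set.range fun k => V k + S k) := by
    refine ⟨M + ∑' j, s j, ?_⟩
    rintro _ ⟨k, rfl⟩
    exact add_le_add (hM k) (hs.sum_le_tsum _ fun j _ => hs0 j)
  have h := (tendsto_atTop_ciSup hmono hbdd).sub hs.hasSum.tendsto_sum_nat
  exact ⟨_, h.congr fun k => by simp [hS]⟩

lemma summable_of_succ_le_sub {N A : ℕ → ℝ} {c : ℝ} (hc : 0 < c) (hN : ∀ k, 0 ≤ N k)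
    (hA : ∀ k, 0 ≤ A k) (h : ∀ k, N (k + 1) ≤ N k - c * A k) : Summable A := by
  refine summable_of_sum_range_le (c := N 0 / c) hA fun n => ?_
  have key : c * ∑ k ∈ Finset.range n, A k ≤ N 0 - N n := by
    induction n with
    | zero => simp
    | succ n ih => rw [Finset.sum_range_succ, mul_add]; linarith [h n]
  rw [le_div_iff₀ hc]
  linarith [hN n]

/-- An antitone nonnegative sequence whose Cesàro means vanish asymptotically tends to zero. -/
lemma tendsto_zero_of_antitone_of_sum_le {N : ℕ → ℝ} (hN : ∀ k, 0 ≤ N k) (hanti : Antitone N)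
    (h : ∀ ε > 0, ∃ K, ∀ n : ℕ, ∑ k ∈ Finset.range n, N k ≤ K + n * ε) :
    Tendsto N atTop (𝓝 0) := by
  rw [Metric.tendsto_atTop]
  intro ε hε
  obtain ⟨K, hK⟩ := h (ε / 3) (by positivity)
  obtain ⟨m, hm⟩ := exists_nat_gt (K / (ε / 3))
  refine ⟨m + 1, fun n hn => ?_⟩
  rw [Real.dist_0_eq_abs, abs_of_nonneg (hN n)]
  by_contra! hcon
  have h1 : ((n : ℕ) : ℝ) * ε ≤ ∑ k ∈ Finset.range n, N k := by
    rw [← nsmul_eq_mul, ← Finset.card_range n, ← Finset.sum_const, Finset.card_range]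
    exact Finset.sum_le_sum fun k hk => hcon.trans (hanti (Finset.mem_range.1 hk).le)
  have h2 := hK n
  rw [div_lt_iff₀ (by positivity)] at hm
  have h3 : (m : ℝ) + 1 ≤ n := by exact_mod_cast hn
  nlinarith

/-- A nonnegative sequence cannot decrease by a fixed amount forever, even up to a summable
relative error. -/
lemma false_of_succ_le_mul_sub {q s : ℕ → ℝ} {c : ℝ} (hc : 0 < c) (hq : ∀ k, 0 ≤ q k)
    (hs0 : ∀ k, 0 ≤ s k) (hs : Summable s)
    (h : ∀ᶠ k in atTop, q (k + 1) ≤ (1 + s k) * q k - c) : False := by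
  obtain ⟨K, hK⟩ := eventually_atTop.1 h
  set S : ℕ → ℝ := fun k => ∑ j ∈ Finset.range k, s j with hS
  set T := ∑' j, s j with hT
  have hST : ∀ k, S k ≤ T := fun k => hs.sum_le_tsum _ fun j _ => hs0 j
  -- Discounting by exp(-S) absorbs the factors 1 + s k; since S ≤ T, each decrement is still worth
  -- at least c exp(-T).
  have step : ∀ k ≥ K, q (k + 1) * Real.exp (-S (k + 1)) ≤
      q k * Real.exp (-S k) - c * Real.exp (-T) := by
    intro k hk
    have e1 : Real.exp (-S k) = Real.exp (s k) * Real.exp (-S (k + 1)) := by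
      rw [← Real.exp_add]
      congr 1
      simp only [hS, Finset.sum_range_succ]
      ring
    have e2 : Real.exp (-T) ≤ Real.exp (-S (k + 1)) :=
      Real.exp_le_exp.2 (neg_le_neg (hST _))
    have e3 : q (k + 1) ≤ Real.exp (s k) * q k - c := by
      have := mul_le_mul_of_nonneg_right (Real.add_one_le_exp (s k)) (hq k)
      linarith [hK k hk]
    have e4 := mul_le_mul_of_nonneg_right e3 (Real.exp_pos (-S (k + 1))).le
    have e5 := mul_le_mul_of_nonneg_left e2 hc.le
    rw [e1]
    linarith
  have iter : ∀ m : ℕ, q (K + m) * Real.exp (-S (K + m)) ≤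
      q K * Real.exp (-S K) - m * (c * Real.exp (-T)) := by
    intro m
    induction m with
    | zero => simp
    | succ m ih =>
      have := step (K + m) (by omega)
      rw [← add_assoc]
      push_cast
      linarith
  have hpos : 0 < c * Real.exp (-T) := mul_pos hc (Real.exp_pos _)
  obtain ⟨m, hm⟩ := exists_nat_gt (q K * Real.exp (-S K) / (c * Real.exp (-T)))
  rw [div_lt_iff₀ hpos] at hm
  have h1 := iter m
  have h2 := mul_nonneg (hq (K + m)) (Real.exp_pos (-S (K + m))).le
  linarith

end RealSequences

/-! ### The primal-dual iteration in abstract form -/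

section PrimalDual

variable {X Y : Type*} [NormedAddCommGroup X] [InnerProductSpace ℝ X]
  [NormedAddCommGroup Y] [InnerProductSpace ℝ Y]

open scoped RealInnerProductSpace

/-- `F' x` is a gradient of `F` at `x`, with `F` strongly convex of modulus `μ` and smooth of
modulus `L`, both expressed by quadratic bounds on the first-order remainder. -/
structure HasQuadraticBounds (F : X → ℝ) (F' : X → X) (μ L : ℝ) : Prop where
  lower : ∀ x u, F x + ⟪F' x, u - x⟫ + μ / 2 * ‖u - x‖ ^ 2 ≤ F u
  upper : ∀ x u, F u ≤ F x + ⟪F' x, u - x⟫ + L / 2 * ‖u - x‖ ^ 2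

/-- The Lagrangian `F u + ⟪B u, v⟫ - g v`. -/
noncomputable def lagrangian (F : X → ℝ) (g : Y → ℝ) (B : X →L[ℝ] Y) (u : X) (v : Y) : ℝ :=
  F u + ⟪B u, v⟫ - g v

/-- The quadratic form `‖a‖² / τ - 2 ⟪B a, b⟫ + ‖b‖² / σ` of the primal-dual metric. -/
noncomputable def pdForm (B : X →L[ℝ] Y) (τ σ : ℝ) (a : X) (b : Y) : ℝ :=
  τ⁻¹ * ‖a‖ ^ 2 - 2 * ⟪B a, b⟫ + σ⁻¹ * ‖b‖ ^ 2

variable {F : X → ℝ} {F' : X → X} {μ L τ σ ρ : ℝ} {C : Set X} {g : Y → ℝ} {D : Set Y}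
  {B : X →L[ℝ] Y}

lemma abs_inner_map_le (B : X →L[ℝ] Y) (a : X) (b : Y) {δ : ℝ} (hδ : 0 < δ) :
    |⟪B a, b⟫| ≤ δ / 2 * ‖b‖ ^ 2 + ‖B‖ ^ 2 / (2 * δ) * ‖a‖ ^ 2 := by
  have h1 : |⟪B a, b⟫| ≤ ‖B‖ * ‖a‖ * ‖b‖ :=
    (abs_real_inner_le_norm _ _).trans (by gcongr; exact B.le_opNorm a)
  have h2 : δ / 2 * ‖b‖ ^ 2 + ‖B‖ ^ 2 / (2 * δ) * ‖a‖ ^ 2 - ‖B‖ * ‖a‖ * ‖b‖ =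
      (δ * ‖b‖ - ‖B‖ * ‖a‖) ^ 2 / (2 * δ) := by
    field_simp
    ring
  have h3 : 0 ≤ (δ * ‖b‖ - ‖B‖ * ‖a‖) ^ 2 / (2 * δ) := by positivity
  linarith

/-- Young's inequality with weight σ⁻¹ spends the whole ‖b‖² term, which gives the best constant for
‖a‖², the one in the step-size condition. -/
lemma le_pdForm (hσ : 0 < σ) (a : X) (b : Y) :
    (1 / τ - σ * ‖B‖ ^ 2) * ‖a‖ ^ 2 ≤ pdForm B τ σ a b := by
  have h := (le_abs_self _).trans (abs_inner_map_le B a b (inv_pos.2 hσ))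
  have e : ‖B‖ ^ 2 / (2 * σ⁻¹) = σ * ‖B‖ ^ 2 / 2 := by field_simp
  rw [e] at h
  unfold pdForm
  rw [one_div]
  linarith

/-- Only half of the ‖b‖² term is spent here, so dual displacements can be recovered from the metric
and the primal ones. -/
lemma norm_sq_le_pdForm (hσ : 0 < σ) (hτ : 0 < τ) (a : X) (b : Y) :
    ‖b‖ ^ 2 ≤ 2 * σ * pdForm B τ σ a b + 4 * σ ^ 2 * ‖B‖ ^ 2 * ‖a‖ ^ 2 := by
  have h := (le_abs_self _).trans (abs_inner_map_le B a b (half_pos (inv_pos.2 hσ)))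
  have e : ‖B‖ ^ 2 / (2 * (σ⁻¹ / 2)) = σ * ‖B‖ ^ 2 := by field_simp
  rw [e] at h
  have h2 : σ⁻¹ * ‖b‖ ^ 2 / 2 ≤ pdForm B τ σ a b + 2 * σ * ‖B‖ ^ 2 * ‖a‖ ^ 2 := by
    have : 0 ≤ τ⁻¹ * ‖a‖ ^ 2 := by positivity
    unfold pdForm
    linarith
  have h3 := mul_le_mul_of_nonneg_left h2 (by positivity : 0 ≤ 2 * σ)
  have h4 : 2 * σ * (σ⁻¹ * ‖b‖ ^ 2 / 2) = ‖b‖ ^ 2 := by field_simp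
  rw [h4] at h3
  linarith

lemma HasQuadraticBounds.strongly_monotone (h : HasQuadraticBounds F F' μ L) (x u : X) :
    μ * ‖u - x‖ ^ 2 ≤ ⟪F' u - F' x, u - x⟫ := by
  have h1 := h.lower x u
  have h2 := h.lower u x
  rw [norm_sub_rev x u, ← neg_sub u x, inner_neg_right] at h2
  rw [inner_sub_left]
  linarith

/-- The lower bound at x and the upper bound at u are compared at one gradient step from u for F -
⟪F' x, ·⟫. -/
lemma HasQuadraticBounds.add_norm_sq_le (h : HasQuadraticBounds F F' μ L) (hμ : 0 ≤ μ) (hL : 0 < L)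
    (x u : X) : F x + ⟪F' x, u - x⟫ + 1 / (2 * L) * ‖F' u - F' x‖ ^ 2 ≤ F u := by
  set δ := F' u - F' x with hδ
  have h1 := h.lower x (u - L⁻¹ • δ)
  have h2 := h.upper u (u - L⁻¹ • δ)
  have h3 : 0 ≤ μ / 2 * ‖u - L⁻¹ • δ - x‖ ^ 2 := by positivity
  have e1 : ⟪F' x, u - L⁻¹ • δ - x⟫ = ⟪F' x, u - x⟫ - L⁻¹ * ⟪F' x, δ⟫ := by
    rw [sub_right_comm, inner_sub_right, inner_smul_right]
  have e2 : ⟪F' u, u - L⁻¹ • δ - u⟫ = - (L⁻¹ * ⟪F' u, δ⟫) := by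
    rw [sub_right_comm, sub_self, zero_sub, inner_neg_right, inner_smul_right]
  have e3 : ‖u - L⁻¹ • δ - u‖ ^ 2 = L⁻¹ ^ 2 * ‖δ‖ ^ 2 := by
    rw [sub_right_comm, sub_self, zero_sub, norm_neg, norm_smul, mul_pow, Real.norm_eq_abs, sq_abs]
  have e4 : ⟪F' u, δ⟫ - ⟪F' x, δ⟫ = ‖δ‖ ^ 2 := by
    rw [← inner_sub_left, ← hδ, real_inner_self_eq_norm_sq]
  rw [e1] at h1
  rw [e2, e3] at h2
  have e5 : L / 2 * (L⁻¹ ^ 2 * ‖δ‖ ^ 2) = 1 / (2 * L) * ‖δ‖ ^ 2 := by field_simp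
  have e6 : L⁻¹ * ⟪F' u, δ⟫ - L⁻¹ * ⟪F' x, δ⟫ = 2 * (1 / (2 * L) * ‖δ‖ ^ 2) := by
    rw [← mul_sub, e4]; field_simp
  linarith

/-- The Baillon-Haddad inequality. -/
lemma HasQuadraticBounds.cocoercive (h : HasQuadraticBounds F F' μ L) (hμ : 0 ≤ μ) (hL : 0 < L)
    (x u : X) : 1 / L * ‖F' u - F' x‖ ^ 2 ≤ ⟪F' u - F' x, u - x⟫ := by
  have h1 := h.add_norm_sq_le hμ hL x u
  have h2 := h.add_norm_sq_le hμ hL u x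
  rw [norm_sub_rev (F' x), ← neg_sub u x, inner_neg_right] at h2
  rw [inner_sub_left]
  have e : 1 / L = 1 / (2 * L) + 1 / (2 * L) := by field_simp; norm_num
  rw [e]
  linarith

/-- The monotonicity is split: the share L/(2κ) is used as cocoercivity, which pays for the cross
term with w by Young's inequality, and the rest as strong monotonicity. The share is below 1 exactly
because κ > L/2. -/
lemma HasQuadraticBounds.inner_add_ge (h : HasQuadraticBounds F F' μ L) (hμ : 0 ≤ μ) (hL : 0 < L)
    {κ : ℝ} (hκ : L / 2 < κ) (x u w : X) :
    (1 - L / (2 * κ)) * μ * ‖u - x‖ ^ 2 - κ / 2 * ‖w‖ ^ 2 ≤ ⟪F' u - F' x, u - x + w⟫ := by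
  have hκ0 : 0 < κ := by linarith
  set δ := F' u - F' x with hδ
  have hθ : 0 ≤ 1 - L / (2 * κ) := by
    rw [sub_nonneg, div_le_one (by positivity)]
    linarith
  have h1 := mul_le_mul_of_nonneg_left (h.strongly_monotone x u) hθ
  have h2 := mul_le_mul_of_nonneg_left (h.cocoercive hμ hL x u)
    (by positivity : 0 ≤ L / (2 * κ))
  have h3 : 0 ≤ 1 / (2 * κ) * ‖δ + κ • w‖ ^ 2 := by positivity
  rw [norm_add_sq_real, norm_smul, inner_smul_right, Real.norm_eq_abs, mul_pow, sq_abs] at h3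
  have e1 : L / (2 * κ) * (1 / L * ‖δ‖ ^ 2) = 1 / (2 * κ) * ‖δ‖ ^ 2 := by field_simp
  have e2 : 1 / (2 * κ) * (‖δ‖ ^ 2 + 2 * (κ * ⟪δ, w⟫) + κ ^ 2 * ‖w‖ ^ 2) =
      1 / (2 * κ) * ‖δ‖ ^ 2 + ⟪δ, w⟫ + κ / 2 * ‖w‖ ^ 2 := by field_simp
  rw [← hδ, e1] at h2
  rw [e2] at h3
  rw [inner_add_right]
  linarith

variable [CompleteSpace X] [CompleteSpace Y]

/-- The optimality conditions characterizing the (unrelaxed) primal-dual step from `(x, y)` to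
`(xt, yt)`, where `g` is a convex function with domain `D`. -/
structure IsPrimalDualStep (F' : X → X) (C : Set X) (g : Y → ℝ) (D : Set Y) (B : X →L[ℝ] Y)
    (τ σ : ℝ) (x : X) (y : Y) (xt : X) (yt : Y) : Prop where
  primal_mem : xt ∈ C
  dual_mem : yt ∈ D
  primal : ∀ u ∈ C, ⟪τ⁻¹ • (x - xt) - F' x - B.adjoint y, u - xt⟫ ≤ 0
  dual : ∀ v ∈ D, g yt + ⟪σ⁻¹ • (y - yt) + B ((2 : ℝ) • xt - x), v - yt⟫ ≤ g v

/-! ### Estimates for one step and for two consecutive steps -/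

section Step

variable {x : X} {y : Y} {xt : X} {yt : Y}

/-- F is bounded above at xt and below at u from the same base point x; the projection inequality
handles the linear terms. -/
lemma IsPrimalDualStep.lagrangian_sub_le_left (hF : HasQuadraticBounds F F' μ L)
    (h : IsPrimalDualStep F' C g D B τ σ x y xt yt) {u : X} (hu : u ∈ C) :
    lagrangian F g B xt yt - lagrangian F g B u yt ≤
      - (τ⁻¹ * ⟪xt - x, xt - u⟫) + ⟪B (xt - u), yt - y⟫ + L / 2 * ‖xt - x‖ ^ 2
        - μ / 2 * ‖u - x‖ ^ 2 := by
  have h1 := h.primal u hu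
  have h2 := hF.lower x u
  have h3 := hF.upper x xt
  simp only [lagrangian, map_sub, inner_sub_left, inner_sub_right, inner_smul_left,
    ContinuousLinearMap.adjoint_inner_left, conj_trivial] at *
  rw [real_inner_comm (B u) y, real_inner_comm (B xt) y] at h1
  linarith

lemma IsPrimalDualStep.lagrangian_sub_le_right (F : X → ℝ)
    (h : IsPrimalDualStep F' C g D B τ σ x y xt yt) {v : Y} (hv : v ∈ D) :
    lagrangian F g B xt v - lagrangian F g B xt yt ≤
      σ⁻¹ * ⟪yt - y, v - yt⟫ - ⟪B (xt - x), v - yt⟫ := by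
  have h1 := h.dual v hv
  simp only [lagrangian, map_sub, map_smul, inner_sub_left, inner_sub_right, inner_smul_left,
    inner_add_left, conj_trivial] at *
  linarith

variable {x' : X} {y' : Y} {xt' : X} {yt' : Y}

/-- The displacement of the relaxed primal-dual iteration decreases in the primal-dual metric. -/
lemma IsPrimalDualStep.pdForm_succ_le (hF : HasQuadraticBounds F F' μ L) (hμ : 0 ≤ μ) (hL : 0 < L)
    (hσ : 0 < σ) (hstep : L / 2 < 1 / τ - σ * ‖B‖ ^ 2) (hρ : ρ ∈ Set.Ioc (0 : ℝ) 1)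
    (h : IsPrimalDualStep F' C g D B τ σ x y xt yt)
    (h' : IsPrimalDualStep F' C g D B τ σ x' y' xt' yt')
    (hx : x' = x + ρ • (xt - x)) (hy : y' = y + ρ • (yt - y)) :
    pdForm B τ σ (xt' - x') (yt' - y') ≤ pdForm B τ σ (xt - x) (yt - y) -
      2 * ρ * ((1 - L / (2 * (1 / τ - σ * ‖B‖ ^ 2))) * μ) * ‖xt - x‖ ^ 2 := by
  obtain ⟨hρ0, hρ1⟩ := hρ
  set κ := 1 / τ - σ * ‖B‖ ^ 2 with hκ
  obtain ⟨a, rfl⟩ : ∃ a, xt = x + a := ⟨xt - x, by abel⟩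
  obtain ⟨b, rfl⟩ : ∃ b, yt = y + b := ⟨yt - y, by abel⟩
  simp only [add_sub_cancel_left] at hx hy ⊢
  -- Here (a, b) is the old displacement and (α, β) its change.
  obtain ⟨α, rfl⟩ : ∃ α, xt' = x' + a + α := ⟨xt' - x' - a, by abel⟩
  obtain ⟨β, rfl⟩ : ∃ β, yt' = y' + b + β := ⟨yt' - y' - b, by abel⟩
  have p1 := h.primal _ h'.primal_mem
  have p2 := h'.primal _ h.primal_mem
  have d1 := h.dual _ h'.dual_mem
  have d2 := h'.dual _ h.dual_mem
  have c1 := hF.inner_add_ge hμ hL hstep x x' α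
  have e1 : x' - x = ρ • a := by rw [hx]; abel
  have n1 := le_pdForm (B := B) (τ := τ) hσ α β
  rw [← hκ] at n1
  rw [e1, norm_smul, mul_pow, Real.norm_eq_abs, sq_abs] at c1
  -- The two primal inequalities are tested at each other's points and added: monotonicity of the
  -- normal cone. The dual ones are treated likewise in `s2`.
  have s1 : ⟪τ⁻¹ • α + (F' x' - F' x) + ρ • B.adjoint b, ρ • a + α⟫ ≤ 0 := by
    have e2 : x' + a + α - (x + a) = ρ • a + α := by rw [hx]; abel
    have e3 : x + a - (x' + a + α) = -(ρ • a + α) := by rw [hx]; abel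
    rw [e2] at p1
    rw [e3, inner_neg_right] at p2
    have e4 : τ⁻¹ • α + (F' x' - F' x) + ρ • B.adjoint b =
        (τ⁻¹ • (x - (x + a)) - F' x - B.adjoint y) -
          (τ⁻¹ • (x' - (x' + a + α)) - F' x' - B.adjoint y') := by
      rw [hy, map_add, map_smul]
      module
    rw [e4, inner_sub_left]
    linarith
  have s2 : ⟪σ⁻¹ • β - B (ρ • a + (2 : ℝ) • α), ρ • b + β⟫ ≤ 0 := by
    have e2 : y' + b + β - (y + b) = ρ • b + β := by rw [hy]; abel
    have e3 : y + b - (y' + b + β) = -(ρ • b + β) := by rw [hy]; abel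
    rw [e2] at d1
    rw [e3, inner_neg_right] at d2
    have e4 : σ⁻¹ • β - B (ρ • a + (2 : ℝ) • α) =
        (σ⁻¹ • (y - (y + b)) + B ((2 : ℝ) • (x + a) - x)) -
          (σ⁻¹ • (y' - (y' + b + β)) + B ((2 : ℝ) • (x' + a + α) - x')) := by
      rw [hx]
      simp only [map_add, map_sub, map_smul]
      module
    rw [e4, inner_sub_left]
    linarith
  have e5 : x' + a + α - x' = a + α := by abel
  have e6 : y' + b + β - y' = b + β := by abel
  rw [e5, e6]
  -- In twice the sum of `s1` and `s2`, one of the two copies of the form at (α, β) absorbs the loss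
  -- κ‖α‖² from `c1`. The extrapolation 2xt - x makes the coupling terms fit the form.
  have m1 : ρ * (2 * ((1 - L / (2 * κ)) * μ) * ρ * ‖a‖ ^ 2) + pdForm B τ σ α β
      + ρ * (pdForm B τ σ (a + α) (b + β) - pdForm B τ σ a b - pdForm B τ σ α β) ≤ 0 := by
    simp only [pdForm, map_add, map_smul, inner_add_left, inner_add_right, inner_smul_left,
      inner_smul_right, inner_sub_left, inner_sub_right, conj_trivial, norm_add_sq_real,
      ContinuousLinearMap.adjoint_inner_left, real_inner_self_eq_norm_sq] at *
    rw [real_inner_comm (B a) b, real_inner_comm (B α) b, real_inner_comm a α] at s1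
    rw [real_inner_comm b β] at s2
    linarith
  have m2 : 0 ≤ pdForm B τ σ α β := by
    refine le_trans (mul_nonneg ?_ (sq_nonneg _)) n1
    linarith
  have m3 : ρ * (pdForm B τ σ (a + α) (b + β) - pdForm B τ σ a b +
      2 * ρ * ((1 - L / (2 * κ)) * μ) * ‖a‖ ^ 2) ≤ 0 := by nlinarith
  nlinarith [nonpos_of_mul_nonpos_right m3 hρ0]

/-- The passage goes through the mixed point (xt', yt). Dual displacements are not known to be
square summable, so their contributions must telescope; only primal ones may remain as errors. -/
lemma IsPrimalDualStep.lagrangian_succ_ge (hF : HasQuadraticBounds F F' μ L) (hμ : 0 ≤ μ)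
    (hL : 0 < L) (hτ : 0 < τ) (hσ : 0 < σ) (hρ : ρ ∈ Set.Ioc (0 : ℝ) 1)
    (h : IsPrimalDualStep F' C g D B τ σ x y xt yt)
    (h' : IsPrimalDualStep F' C g D B τ σ x' y' xt' yt')
    (hx : x' = x + ρ • (xt - x)) (hy : y' = y + ρ • (yt - y)) :
    lagrangian F g B xt yt - (1 / 2 + ρ / 4) / σ * ‖yt - y‖ ^ 2 ≤
      lagrangian F g B xt' yt' - (1 / 2 + ρ / 4) / σ * ‖yt' - y'‖ ^ 2 +
        (L / 2 + 2 * τ⁻¹ + 4 * (σ / ρ) * ‖B‖ ^ 2) * (‖xt - x‖ ^ 2 + ‖xt' - x'‖ ^ 2) := by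
  obtain ⟨hρ0, hρ1⟩ := hρ
  have l1 := h.lagrangian_sub_le_left hF h'.primal_mem
  have l2 := h'.lagrangian_sub_le_right F h.dual_mem
  obtain ⟨a, rfl⟩ : ∃ a, xt = x + a := ⟨xt - x, by abel⟩
  obtain ⟨b, rfl⟩ : ∃ b, yt = y + b := ⟨yt - y, by abel⟩
  obtain ⟨a', rfl⟩ : ∃ a', xt' = x' + a' := ⟨xt' - x', by abel⟩
  obtain ⟨b', rfl⟩ : ∃ b', yt' = y' + b' := ⟨yt' - y', by abel⟩
  simp only [add_sub_cancel_left] at hx hy l1 l2 ⊢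
  have e1 : x + a - (x' + a') = (1 - ρ) • a - a' := by rw [hx]; module
  have e2 : y + b - (y' + b') = (1 - ρ) • b - b' := by rw [hy]; module
  rw [e1] at l1
  rw [e2] at l2
  -- Each coupling term then costs ρ/(4σ) of ‖b‖² or ‖b'‖². Three fall on b and one on b', so the
  -- coefficients 1/2 - ρ/2 + 3ρ/4 and 1/2 + ρ/2 - ρ/4 agree.
  have hδ : 0 < ρ / (2 * σ) := by positivity
  have y1 := abs_le.1 (abs_inner_map_le B a b hδ)
  have y2 := abs_le.1 (abs_inner_map_le B a' b hδ)
  have y3 := abs_le.1 (abs_inner_map_le B a' b' hδ)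
  have e3 : ‖B‖ ^ 2 / (2 * (ρ / (2 * σ))) = σ / ρ * ‖B‖ ^ 2 := by field_simp
  rw [e3] at y1 y2 y3
  simp only [map_sub, map_smul, inner_sub_left, inner_sub_right, inner_smul_left,
    inner_smul_right, conj_trivial, real_inner_self_eq_norm_sq] at l1 l2
  rw [real_inner_comm b b'] at l2
  have y4 : ∀ {c p r : ℝ}, 0 ≤ c → c ≤ 1 → |p| ≤ r → c * p ≤ r := fun {c p r} h0 h1 h2 =>
    (mul_le_mul_of_nonneg_left ((le_abs_self p).trans h2) h0).trans
      (mul_le_of_le_one_left ((abs_nonneg p).trans h2) h1)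
  have t0 : 0 ≤ 1 - ρ := by linarith
  have t1 : 1 - ρ ≤ 1 := by linarith
  have z1 := y4 t0 t1 (abs_le.2 y1)
  have z2 := y4 t0 t1 ((abs_neg _).trans_le (abs_le.2 y2))
  have z3 : ⟪a, a'⟫ ≤ (‖a‖ ^ 2 + ‖a'‖ ^ 2) / 2 := by
    have := norm_sub_sq_real a a'
    have := sq_nonneg ‖a - a'‖
    linarith
  have z4 : ⟪b, b'⟫ ≤ (‖b‖ ^ 2 + ‖b'‖ ^ 2) / 2 := by
    have := norm_sub_sq_real b b'
    have := sq_nonneg ‖b - b'‖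
    linarith
  have hτ' := inv_pos.2 hτ
  have hσ' := inv_pos.2 hσ
  have w3 := mul_le_mul_of_nonneg_left z3 hτ'.le
  have w4 := mul_le_mul_of_nonneg_left (mul_le_mul_of_nonneg_left z4 t0) hσ'.le
  have w5 : 0 ≤ τ⁻¹ * ((1 - ρ) * ‖a‖ ^ 2) := by positivity
  have w6 : 0 ≤ μ / 2 * ‖x' + a' - x‖ ^ 2 := by positivity
  have w7 : 0 ≤ L / 2 * ‖a'‖ ^ 2 := by positivity
  have w8 : 0 ≤ τ⁻¹ * ‖a‖ ^ 2 := by positivity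
  have w9 : 0 ≤ τ⁻¹ * ‖a'‖ ^ 2 := by positivity
  have w10 : 0 ≤ σ / ρ * ‖B‖ ^ 2 * ‖a‖ ^ 2 := by positivity
  have w11 : 0 ≤ σ / ρ * ‖B‖ ^ 2 * ‖a'‖ ^ 2 := by positivity
  have e4 : ρ / (2 * σ) / 2 = ρ / 4 * σ⁻¹ := by field_simp; norm_num
  have e5 : (1 / 2 + ρ / 4) / σ = (1 / 2 + ρ / 4) * σ⁻¹ := div_eq_mul_inv _ _
  rw [e4] at y1 y2 y3 z1 z2
  rw [e5]
  linarith [y1.1, y1.2, y2.1, y2.2, y3.1, y3.2]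

/-- The duality gap is controlled by the decrease of the distance to `(u, v)` in the primal-dual
metric. -/
lemma IsPrimalDualStep.gap_le (hF : HasQuadraticBounds F F' μ L) (hμ : 0 ≤ μ)
    (hσ : 0 < σ) (hκ : 0 ≤ 1 / τ - σ * ‖B‖ ^ 2) (hρ : ρ ∈ Set.Ioc (0 : ℝ) 1)
    (h : IsPrimalDualStep F' C g D B τ σ x y xt yt)
    (hx : x' = x + ρ • (xt - x)) (hy : y' = y + ρ • (yt - y)) {u : X} {v : Y}
    (hu : u ∈ C) (hv : v ∈ D) :
    2 * ρ * (lagrangian F g B xt v - lagrangian F g B u yt) + ρ * pdForm B τ σ (xt - x) (yt - y) ≤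
      pdForm B τ σ (x - u) (y - v) - pdForm B τ σ (x' - u) (y' - v) + ρ * L * ‖xt - x‖ ^ 2 := by
  obtain ⟨hρ0, hρ1⟩ := hρ
  have l1 := h.lagrangian_sub_le_left hF hu
  have l2 := h.lagrangian_sub_le_right F hv
  have n1 := (mul_nonneg hκ (sq_nonneg _)).trans (le_pdForm (B := B) (τ := τ) hσ (xt - x) (yt - y))
  have w6 : 0 ≤ μ / 2 * ‖u - x‖ ^ 2 := by positivity
  obtain ⟨a, rfl⟩ : ∃ a, xt = x + a := ⟨xt - x, by abel⟩
  obtain ⟨b, rfl⟩ : ∃ b, yt = y + b := ⟨yt - y, by abel⟩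
  simp only [add_sub_cancel_left] at hx hy l1 l2 n1 ⊢
  obtain ⟨p, hp⟩ : ∃ p, p = x - u := ⟨_, rfl⟩
  obtain ⟨q, hq⟩ : ∃ q, q = y - v := ⟨_, rfl⟩
  have e1 : x' - u = p + ρ • a := by rw [hx, hp]; abel
  have e2 : y' - v = q + ρ • b := by rw [hy, hq]; abel
  have e3 : x + a - u = p + a := by rw [hp]; abel
  have e4 : v - (y + b) = -(q + b) := by rw [hq]; abel
  rw [e3] at l1
  rw [e4] at l2
  rw [e1, e2, ← hp, ← hq]
  -- This is the three-point identity of the metric; ρ ≤ 1 gives 2ρ - ρ² ≥ ρ, leaving the required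
  -- multiple of the displacement.
  have key : pdForm B τ σ p q - pdForm B τ σ (p + ρ • a) (q + ρ • b) =
      2 * ρ * (-(τ⁻¹ * ⟪a, p + a⟫) + ⟪B (p + a), b⟫ + σ⁻¹ * ⟪b, -(q + b)⟫ - ⟪B a, -(q + b)⟫) +
        (2 * ρ - ρ ^ 2) * pdForm B τ σ a b := by
    simp only [pdForm, map_add, map_smul, inner_add_left, inner_add_right, inner_smul_left,
      inner_smul_right, inner_neg_right, conj_trivial, norm_add_sq_real, norm_smul, mul_pow,
      Real.norm_eq_abs, sq_abs, real_inner_self_eq_norm_sq]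
    rw [real_inner_comm a p, real_inner_comm b q]
    ring
  rw [key]
  have m1 := mul_le_mul_of_nonneg_left (add_le_add l1 l2) (by positivity : 0 ≤ 2 * ρ)
  have m2 : 0 ≤ (ρ - ρ ^ 2) * pdForm B τ σ a b := mul_nonneg (by nlinarith) n1
  have m3 := mul_nonneg hρ0.le w6
  nlinarith

/-- Weak duality at the iterates, with the strong convexity of the smooth part. -/
lemma IsPrimalDualStep.lagrangian_add_le (hF : HasQuadraticBounds F F' μ L) (hμ : 0 < μ)
    (hτ : 0 < τ) (h : IsPrimalDualStep F' C g D B τ σ x y xt yt) {xs : X}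
    (hxs : xs ∈ C) {p : ℝ} (l2 : lagrangian F g B xs yt ≤ p) :
    lagrangian F g B xt yt + μ / 4 * ‖x - xs‖ ^ 2 ≤
      p + ((2 * τ⁻¹ ^ 2 / μ + τ⁻¹ + L / 2 + ‖B‖ ^ 2 / 2) * ‖xt - x‖ ^ 2 +
        (2 * ‖B‖ ^ 2 / μ + 1 / 2) * ‖yt - y‖ ^ 2) := by
  have l1 := h.lagrangian_sub_le_left hF hxs
  obtain ⟨a, ha⟩ : ∃ a, a = xt - x := ⟨_, rfl⟩
  obtain ⟨b, hb⟩ : ∃ b, b = yt - y := ⟨_, rfl⟩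
  obtain ⟨e, he⟩ : ∃ e, e = x - xs := ⟨_, rfl⟩
  have e1 : xt - xs = e + a := by rw [he, ha]; abel
  rw [← ha, ← hb, e1, norm_sub_rev xs, ← he] at l1
  rw [← ha, ← hb, ← he]
  rw [map_add, inner_add_left, inner_add_right, real_inner_self_eq_norm_sq] at l1
  have y1 := (le_abs_self _).trans (abs_inner_map_le B a b one_pos)
  -- This and `y3` each spend μ/8 of the available μ/2, so μ/4 remains.
  have y2 : ⟪B e, b⟫ ≤ 2 * ‖B‖ ^ 2 / μ * ‖b‖ ^ 2 + μ / 8 * ‖e‖ ^ 2 := by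
    have h1 : ⟪B e, b⟫ ≤ ‖B‖ * ‖e‖ * ‖b‖ :=
      (real_inner_le_norm _ _).trans (by gcongr; exact B.le_opNorm e)
    have h2 : 2 * ‖B‖ ^ 2 / μ * ‖b‖ ^ 2 + μ / 8 * ‖e‖ ^ 2 - ‖B‖ * ‖e‖ * ‖b‖ =
        (4 * ‖B‖ * ‖b‖ - μ * ‖e‖) ^ 2 / (8 * μ) := by
      field_simp
      ring
    have h3 : 0 ≤ (4 * ‖B‖ * ‖b‖ - μ * ‖e‖) ^ 2 / (8 * μ) := by positivity
    linarith
  have y3 : -(τ⁻¹ * ⟪a, e⟫) ≤ 2 * τ⁻¹ ^ 2 / μ * ‖a‖ ^ 2 + μ / 8 * ‖e‖ ^ 2 := by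
    have h0 : 0 ≤ τ⁻¹ := (inv_pos.2 hτ).le
    have h1 : -⟪a, e⟫ ≤ ‖a‖ * ‖e‖ := (neg_le_abs _).trans (abs_real_inner_le_norm a e)
    have h1' := mul_le_mul_of_nonneg_left h1 h0
    have h2 : 2 * τ⁻¹ ^ 2 / μ * ‖a‖ ^ 2 + μ / 8 * ‖e‖ ^ 2 - τ⁻¹ * (‖a‖ * ‖e‖) =
        (4 * τ⁻¹ * ‖a‖ - μ * ‖e‖) ^ 2 / (8 * μ) := by
      have hμ' := hμ.ne'
      rw [eq_div_iff (by positivity), sub_mul, add_mul,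
        show 2 * τ⁻¹ ^ 2 / μ * ‖a‖ ^ 2 * (8 * μ) = 16 * τ⁻¹ ^ 2 * ‖a‖ ^ 2 by
          rw [div_mul_eq_mul_div, div_mul_eq_mul_div, div_eq_iff hμ']; ring]
      ring
    have h3 : 0 ≤ (4 * τ⁻¹ * ‖a‖ - μ * ‖e‖) ^ 2 / (8 * μ) := by positivity
    linarith
  have y4 : 0 ≤ τ⁻¹ * ‖a‖ ^ 2 := by positivity
  have y5 : ‖B‖ ^ 2 / (2 * 1) = ‖B‖ ^ 2 / 2 := by norm_num
  rw [y5] at y1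
  linarith

/-- As long as the Lagrangian stays below a dual value `L(xt, v)`, the dual iterates
approach `v`. -/
lemma IsPrimalDualStep.norm_sq_succ_le (hσ : 0 < σ) (hρ : ρ ∈ Set.Ioc (0 : ℝ) 1)
    (h : IsPrimalDualStep F' C g D B τ σ x y xt yt) (hy : y' = y + ρ • (yt - y)) {v : Y}
    (hv : v ∈ D) {η : ℝ} (hη : 0 < η)
    (k1 : lagrangian F g B xt yt + η ≤ lagrangian F g B xt v)
    (k2 : σ * ‖B‖ ^ 2 * ‖xt - x‖ ^ 2 < η / 2) :
    ‖y' - v‖ ^ 2 ≤ (1 + ρ * σ * (2 / η) * ‖B‖ ^ 2 * ‖xt - x‖ ^ 2) * ‖y - v‖ ^ 2 - ρ * σ * η := by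
  have hρ0 := hρ.1
  have hρ1 := hρ.2
  have l2 := h.lagrangian_sub_le_right F hv
  obtain ⟨a, ha⟩ : ∃ a, a = xt - x := ⟨_, rfl⟩
  obtain ⟨b, hb⟩ : ∃ b, b = yt - y := ⟨_, rfl⟩
  obtain ⟨e, he⟩ : ∃ e, e = y - v := ⟨_, rfl⟩
  have e1 : y' - v = e + ρ • b := by rw [hy, he, hb]; abel
  have e2 : v - yt = -(e + b) := by rw [he, hb]; abel
  rw [e2, ← ha, ← hb, inner_neg_right, inner_neg_right, inner_add_right, inner_add_right,
    real_inner_self_eq_norm_sq] at l2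
  rw [e1, ← ha, ← he, norm_add_sq_real, norm_smul, inner_smul_right, Real.norm_eq_abs, mul_pow,
    sq_abs, real_inner_comm]
  rw [← ha] at k2
  have l4 : η ≤ -(σ⁻¹ * (⟪b, e⟫ + ‖b‖ ^ 2)) + (⟪B a, e⟫ + ⟪B a, b⟫) := by linarith
  have y1 := (le_abs_self _).trans (abs_inner_map_le B a b (inv_pos.2 hσ))
  -- A quarter of η is spent here and a quarter through `k2`; the remaining half, multiplied by 2ρσ,
  -- is the decrement.
  have y2 : ⟪B a, e⟫ ≤ η / 4 + 1 / η * ‖B‖ ^ 2 * ‖a‖ ^ 2 * ‖e‖ ^ 2 := by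
    have h1 : ⟪B a, e⟫ ≤ ‖B‖ * ‖a‖ * ‖e‖ :=
      (real_inner_le_norm _ _).trans (by gcongr; exact B.le_opNorm a)
    have h2 : η / 4 + 1 / η * ‖B‖ ^ 2 * ‖a‖ ^ 2 * ‖e‖ ^ 2 - ‖B‖ * ‖a‖ * ‖e‖ =
        (η - 2 * (‖B‖ * ‖a‖ * ‖e‖)) ^ 2 / (4 * η) := by
      field_simp
      ring
    have h3 : 0 ≤ (η - 2 * (‖B‖ * ‖a‖ * ‖e‖)) ^ 2 / (4 * η) := by positivity
    linarith
  have y3 : ‖B‖ ^ 2 / (2 * σ⁻¹) = σ * ‖B‖ ^ 2 / 2 := by field_simp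
  rw [y3] at y1
  have l5 : σ⁻¹ * ⟪b, e⟫ + σ⁻¹ / 2 * ‖b‖ ^ 2 ≤
      -(η / 2) + 1 / η * ‖B‖ ^ 2 * ‖a‖ ^ 2 * ‖e‖ ^ 2 := by linarith
  have l6 := mul_le_mul_of_nonneg_left l5 (by positivity : 0 ≤ 2 * ρ * σ)
  have l7 : 2 * ρ * σ * (σ⁻¹ * ⟪b, e⟫ + σ⁻¹ / 2 * ‖b‖ ^ 2) =
      2 * (ρ * ⟪b, e⟫) + ρ * ‖b‖ ^ 2 := by field_simp
  have l8 : ρ ^ 2 * ‖b‖ ^ 2 ≤ ρ * ‖b‖ ^ 2 :=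
    mul_le_mul_of_nonneg_right (by nlinarith) (sq_nonneg _)
  rw [l7] at l6
  have l9 : 2 / η = 2 * (1 / η) := by ring
  rw [l9]
  linarith

end Step

/-- The limit of the Lagrangian along the iterates is at least the dual supremum. -/
lemma le_of_tendsto_lagrangian (hσ : 0 < σ) (hρ : ρ ∈ Set.Ioc (0 : ℝ) 1)
    {x xt : ℕ → X} {y yt : ℕ → Y}
    (h : ∀ k, IsPrimalDualStep F' C g D B τ σ (x k) (y k) (xt k) (yt k))
    (hy : ∀ k, y (k + 1) = y k + ρ • (yt k - y k)) {p : ℝ}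
    (hstrong : ∀ ε > 0, ∃ v ∈ D, ∀ u ∈ C, p - ε ≤ lagrangian F g B u v)
    (hsum : Summable fun k => ‖xt k - x k‖ ^ 2) {l : ℝ}
    (hl : Tendsto (fun k => lagrangian F g B (xt k) (yt k)) atTop (𝓝 l)) : p ≤ l := by
  by_contra! hlt
  -- One third is lost in the choice of v and one in the limit of the Lagrangian; the last is the
  -- gap that drives y towards v.
  obtain ⟨η, hη⟩ : ∃ η, η = (p - l) / 3 := ⟨_, rfl⟩
  have hη0 : 0 < η := by rw [hη]; linarith
  have hρ0 := hρ.1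
  obtain ⟨v, hv, hv'⟩ := hstrong η hη0
  have hc : 0 ≤ ρ * σ * (2 / η) * ‖B‖ ^ 2 := by positivity
  refine false_of_succ_le_mul_sub (q := fun k => ‖y k - v‖ ^ 2)
    (s := fun k => ρ * σ * (2 / η) * ‖B‖ ^ 2 * ‖xt k - x k‖ ^ 2) (c := ρ * σ * η)
    (mul_pos (mul_pos hρ0 hσ) hη0) (fun k => sq_nonneg _)
    (fun k => mul_nonneg hc (sq_nonneg _)) (hsum.mul_left _) ?_
  have ev1 := hl.eventually_lt_const (show l < l + η by linarith)
  have ev2 : ∀ᶠ k in atTop, σ * ‖B‖ ^ 2 * ‖xt k - x k‖ ^ 2 < η / 2 := by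
    have := hsum.tendsto_atTop_zero.const_mul (σ * ‖B‖ ^ 2)
    rw [mul_zero] at this
    exact this.eventually_lt_const (half_pos hη0)
  filter_upwards [ev1, ev2] with k k1 k2
  have k3 := hv' _ (h k).primal_mem
  exact (h k).norm_sq_succ_le hσ hρ (hy k) hv hη0 (by linarith) k2

/-- Convergence of the relaxed primal-dual iteration to `xs`, given asymptotic dual optimality:
the dual supremum `p` need not be attained. -/
theorem tendsto_of_isPrimalDualStep (hF : HasQuadraticBounds F F' μ L) (hμ : 0 < μ) (hL : 0 < L)
    (hτ : 0 < τ) (hσ : 0 < σ) (hstep : L / 2 < 1 / τ - σ * ‖B‖ ^ 2) (hρ : ρ ∈ Set.Ioc (0 : ℝ) 1)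
    {x xt : ℕ → X} {y yt : ℕ → Y}
    (h : ∀ k, IsPrimalDualStep F' C g D B τ σ (x k) (y k) (xt k) (yt k))
    (hx : ∀ k, x (k + 1) = x k + ρ • (xt k - x k)) (hy : ∀ k, y (k + 1) = y k + ρ • (yt k - y k))
    {xs : X} (hxs : xs ∈ C) {p : ℝ} (hweak : ∀ v ∈ D, lagrangian F g B xs v ≤ p)
    (hstrong : ∀ ε > 0, ∃ v ∈ D, ∀ u ∈ C, p - ε ≤ lagrangian F g B u v) :
    Tendsto x atTop (𝓝 xs) := by
  have hρ0 := hρ.1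
  have hρ1 := hρ.2
  set κ := 1 / τ - σ * ‖B‖ ^ 2 with hκ
  have hκ0 : 0 < κ := by linarith
  have hpd : ∀ a b, 0 ≤ pdForm B τ σ a b := fun a b =>
    (mul_nonneg hκ0.le (sq_nonneg _)).trans (le_pdForm hσ a b)
  set A : ℕ → ℝ := fun k => ‖xt k - x k‖ ^ 2 with hA
  set N : ℕ → ℝ := fun k => pdForm B τ σ (xt k - x k) (yt k - y k) with hN
  have hA0 : ∀ k, 0 ≤ A k := fun k => sq_nonneg _
  have hN0 : ∀ k, 0 ≤ N k := fun k => hpd _ _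
  have hc : 0 < 2 * ρ * ((1 - L / (2 * κ)) * μ) := by
    have : 0 < 1 - L / (2 * κ) := by
      rw [sub_pos, div_lt_one (by positivity)]
      linarith
    positivity
  have hNs : ∀ k, N (k + 1) ≤ N k - 2 * ρ * ((1 - L / (2 * κ)) * μ) * A k := fun k =>
    (h k).pdForm_succ_le hF hμ.le hL hσ hstep hρ (h (k + 1)) (hx k) (hy k)
  have hAsum : Summable A := summable_of_succ_le_sub hc hN0 hA0 hNs
  have hAt : Tendsto A atTop (𝓝 0) := hAsum.tendsto_atTop_zero
  have hanti : Antitone N := antitone_nat_of_succ_le fun k =>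
    (hNs k).trans (sub_le_self _ (mul_nonneg hc.le (hA0 k)))
  have hNt : Tendsto N atTop (𝓝 0) := by
    refine tendsto_zero_of_antitone_of_sum_le hN0 hanti fun ε hε => ?_
    -- With this v every gap is at least -ε/2, which costs ρε per step and so ε in the Cesàro mean.
    -- The point v depends on ε, but only the initial distance to it enters.
    obtain ⟨v, hv, hv'⟩ := hstrong (ε / 2) (by positivity)
    refine ⟨(pdForm B τ σ (x 0 - xs) (y 0 - v) + ρ * L * ∑' k, A k) / ρ, fun n => ?_⟩
    have key : ρ * ∑ k ∈ Finset.range n, N k ≤ pdForm B τ σ (x 0 - xs) (y 0 - v) -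
        pdForm B τ σ (x n - xs) (y n - v) + ρ * L * ∑ k ∈ Finset.range n, A k + n * (ρ * ε) := by
      induction n with
      | zero => simp
      | succ n ih =>
        have := (h n).gap_le hF hμ.le hσ hκ0.le hρ (hx n) (hy n) hxs hv
        have h1 := hv' _ (h n).primal_mem
        have h2 := hweak _ (h n).dual_mem
        have h3 : 2 * ρ * (-(ε / 2)) ≤ 2 * ρ *
            (lagrangian F g B (xt n) v - lagrangian F g B xs (yt n)) :=
          mul_le_mul_of_nonneg_left (by linarith) (by positivity)
        rw [Finset.sum_range_succ, Finset.sum_range_succ]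
        push_cast
        simp only [hA, hN] at *
        linarith
    have h1 : ρ * L * ∑ k ∈ Finset.range n, A k ≤ ρ * L * ∑' k, A k :=
      mul_le_mul_of_nonneg_left (hAsum.sum_le_tsum _ fun j _ => hA0 j) (by positivity)
    have h2 := hpd (x n - xs) (y n - v)
    rw [← sub_le_iff_le_add, le_div_iff₀ hρ0]
    linarith
  have hbt : Tendsto (fun k => ‖yt k - y k‖ ^ 2) atTop (𝓝 0) := by
    have h1 : Tendsto (fun k => 2 * σ * N k + 4 * σ ^ 2 * ‖B‖ ^ 2 * A k) atTop (𝓝 0) := by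
      simpa using (hNt.const_mul (2 * σ)).add (hAt.const_mul (4 * σ ^ 2 * ‖B‖ ^ 2))
    exact squeeze_zero (fun _ => sq_nonneg _) (fun k => norm_sq_le_pdForm hσ hτ _ _) h1
  set Λ : ℕ → ℝ := fun k => lagrangian F g B (xt k) (yt k) with hΛ
  -- an upper bound for the Lagrangian along the iterates
  set r : ℕ → ℝ := fun k => (2 * τ⁻¹ ^ 2 / μ + τ⁻¹ + L / 2 + ‖B‖ ^ 2 / 2) * A k +
    (2 * ‖B‖ ^ 2 / μ + 1 / 2) * ‖yt k - y k‖ ^ 2 with hr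
  have hrt : Tendsto r atTop (𝓝 0) := by
    have := (hAt.const_mul (2 * τ⁻¹ ^ 2 / μ + τ⁻¹ + L / 2 + ‖B‖ ^ 2 / 2)).add
      (hbt.const_mul (2 * ‖B‖ ^ 2 / μ + 1 / 2))
    rwa [mul_zero, mul_zero, add_zero] at this
  have hup : ∀ k, Λ k + μ / 4 * ‖x k - xs‖ ^ 2 ≤ p + r k := by
    intro k
    exact (h k).lagrangian_add_le hF hμ hτ hxs (hweak _ (h k).dual_mem)
  -- the Lagrangian converges along the iterates
  obtain ⟨l, hl⟩ : ∃ l, Tendsto Λ atTop (𝓝 l) := by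
    set c₁ := (1 / 2 + ρ / 4) / σ with hc₁
    set c₂ := L / 2 + 2 * τ⁻¹ + 4 * (σ / ρ) * ‖B‖ ^ 2 with hc₂
    have hc₁0 : 0 ≤ c₁ := by positivity
    have hc₂0 : 0 ≤ c₂ := by positivity
    obtain ⟨M, hM⟩ := hrt.bddAbove_range
    have hs : Summable fun k => c₂ * (A k + A (k + 1)) :=
      (hAsum.add ((summable_nat_add_iff 1).2 hAsum)).mul_left c₂
    -- The subtracted dual term tends to zero, so it does not affect the limit.
    obtain ⟨l, hl⟩ := tendsto_of_le_add_summable (V := fun k => Λ k - c₁ * ‖yt k - y k‖ ^ 2)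
      (M := p + M) (fun k => mul_nonneg hc₂0 (add_nonneg (hA0 k) (hA0 (k + 1)))) hs
      (fun k => (h k).lagrangian_succ_ge hF hμ.le hL hτ hσ hρ (h (k + 1)) (hx k) (hy k))
      (fun k => by
        have h1 := hup k
        have h2 : r k ≤ M := hM ⟨k, rfl⟩
        have h3 : 0 ≤ μ / 4 * ‖x k - xs‖ ^ 2 := by positivity
        have h4 : 0 ≤ c₁ * ‖yt k - y k‖ ^ 2 := by positivity
        linarith)
    refine ⟨l, ?_⟩
    simpa using hl.add (hbt.const_mul c₁)
  have hlp : p ≤ l := le_of_tendsto_lagrangian hσ hρ h hy hstrong hAsum hl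
  have hfin : Tendsto (fun k => ‖x k - xs‖ ^ 2) atTop (𝓝 0) := by
    have h1 : Tendsto (fun k => 4 / μ * (l - Λ k + r k)) atTop (𝓝 0) := by
      simpa using ((tendsto_const_nhds (x := l)).sub hl |>.add hrt).const_mul (4 / μ)
    refine squeeze_zero (fun _ => sq_nonneg _) (fun k => ?_) h1
    have h2 : μ / 4 * ‖x k - xs‖ ^ 2 ≤ l - Λ k + r k := by linarith [hup k]
    have h3 := mul_le_mul_of_nonneg_left h2 (by positivity : 0 ≤ 4 / μ)
    have h4 : 4 / μ * (μ / 4 * ‖x k - xs‖ ^ 2) = ‖x k - xs‖ ^ 2 := by field_simp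
    rwa [h4] at h3
  rw [tendsto_iff_norm_sub_tendsto_zero]
  have := hfin.sqrt
  simpa [Real.sqrt_sq (norm_nonneg _)] using this

end PrimalDual

/-! ### Minimization over sets of pairs, for use with epigraphs -/

section Minimization

/-- Existence of a minimizer of `h v + t` over a closed set of pairs `(v, t)` with `0 ≤ t`,
for `h` continuous, bounded below and with bounded sublevel sets. -/
lemma exists_forall_add_le {V : Type*} [NormedAddCommGroup V] [ProperSpace V]
    {K : Set (V × ℝ)} (hK : IsClosed K) (hK0 : ∀ q ∈ K, 0 ≤ q.2) (hne : K.Nonempty) {h : V → ℝ}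
    (hh : Continuous h) {m : ℝ} (hm : ∀ v, m ≤ h v)
    (hb : ∀ c, Bornology.IsBounded {v | h v ≤ c}) :
    ∃ q ∈ K, ∀ r ∈ K, h q.1 + q.2 ≤ h r.1 + r.2 := by
  obtain ⟨q₀, hq₀⟩ := hne
  have hcont : Continuous fun q : V × ℝ => h q.1 + q.2 := by fun_prop
  set c := h q₀.1 + q₀.2 with hc
  have hcomp : IsCompact (K ∩ {q | h q.1 + q.2 ≤ c}) := by
    refine Metric.isCompact_of_isClosed_isBounded
      (hK.inter (isClosed_le hcont continuous_const)) ?_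
    refine ((hb c).prod (Metric.isBounded_Icc 0 (c - m))).subset ?_
    rintro ⟨v, t⟩ ⟨h1, h2⟩
    have h3 := hK0 _ h1
    have h4 := hm v
    simp only [Set.mem_ofPred_eq] at h2 h3
    exact ⟨by simp only [Set.mem_ofPred_eq]; linarith, h3, by linarith⟩
  obtain ⟨q, hq, hq'⟩ := hcomp.exists_isMinOn ⟨q₀, hq₀, le_refl c⟩ hcont.continuousOn
  refine ⟨q, hq.1, fun r hr => ?_⟩
  by_cases hrc : h r.1 + r.2 ≤ c
  · exact hq' ⟨hr, hrc⟩
  · exact le_trans hq.2 (not_le.1 hrc).le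

/-- First-order optimality over a convex set of pairs `(v, t)` for the objective `h v + t`. -/
lemma le_add_of_forall_add_le {V : Type*} [AddCommGroup V] [Module ℝ V]
    {K : Set (V × ℝ)} (hK : Convex ℝ K) {h : V → ℝ} {q r : V × ℝ} (hq : q ∈ K) (hr : r ∈ K)
    (hmin : ∀ r ∈ K, h q.1 + q.2 ≤ h r.1 + r.2) {m c : ℝ}
    (hexp : ∀ θ : ℝ, h (q.1 + θ • (r.1 - q.1)) ≤ h q.1 + θ * m + θ ^ 2 * c) :
    q.2 ≤ r.2 + m := by
  -- Minimality along the segment from q to r, divided by θ; then θ tends to 0.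
  have key : ∀ θ : ℝ, 0 < θ → θ ≤ 1 → 0 ≤ (r.2 - q.2 + m) + θ * c := by
    intro θ h0 h1
    have h2 := hmin _ (hK.add_smul_sub_mem hq hr ⟨h0.le, h1⟩)
    have h3 := hexp θ
    simp only [Prod.fst_add, Prod.smul_fst, Prod.fst_sub, Prod.snd_add, Prod.smul_snd,
      Prod.snd_sub, smul_eq_mul] at h2
    have h4 : 0 ≤ θ * ((r.2 - q.2 + m) + θ * c) := by nlinarith
    exact nonneg_of_mul_nonneg_right h4 h0
  have hlim : Tendsto (fun θ : ℝ => (r.2 - q.2 + m) + θ * c) (𝓝[>] 0) (𝓝 (r.2 - q.2 + m)) := by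
    have : Continuous fun θ : ℝ => (r.2 - q.2 + m) + θ * c := by fun_prop
    have h := (this.tendsto 0).mono_left (nhdsWithin_le_nhds (s := Set.Ioi 0))
    simpa using h
  have h0 : 0 ≤ r.2 - q.2 + m := by
    refine ge_of_tendsto hlim ?_
    filter_upwards [Ioc_mem_nhdsGT (zero_lt_one' ℝ)] with θ hθ
    exact key θ hθ.1 hθ.2
  linarith

end Minimization

/-! ### Differentiability and coercivity from quadratic bounds -/

section QuadraticBounds

variable {X : Type*} [NormedAddCommGroup X] [InnerProductSpace ℝ X]
  {F : X → ℝ} {F' : X → X} {μ L : ℝ}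

open scoped RealInnerProductSpace

lemma HasQuadraticBounds.hasGradientAt [CompleteSpace X] (h : HasQuadraticBounds F F' μ L)
    (hμ : 0 ≤ μ) (x : X) : HasGradientAt F (F' x) x := by
  rw [hasGradientAt_iff_isLittleO]
  have h1 : (fun u => F u - F x - ⟪F' x, u - x⟫) =O[𝓝 x] fun u => ‖u - x‖ ^ 2 := by
    refine Asymptotics.IsBigO.of_bound (L / 2) (Eventually.of_forall fun u => ?_)
    have h2 := h.lower x u
    have h3 := h.upper x u
    have h4 : 0 ≤ μ / 2 * ‖u - x‖ ^ 2 := by positivity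
    rw [Real.norm_of_nonneg (by linarith), Real.norm_of_nonneg (sq_nonneg _)]
    linarith
  refine h1.trans_isLittleO ?_
  have h5 : Tendsto (fun u => u - x) (𝓝 x) (𝓝 0) := by
    have : Continuous fun u => u - x := by fun_prop
    simpa using this.tendsto x
  exact (Asymptotics.isLittleO_norm_pow_id one_lt_two).comp_tendsto h5

lemma HasQuadraticBounds.add_norm_sq_le_apply (h : HasQuadraticBounds F F' μ L) (hμ : 0 < μ)
    (u : X) : F 0 - ‖F' 0‖ ^ 2 / μ + μ / 4 * ‖u‖ ^ 2 ≤ F u := by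
  have h1 := h.lower 0 u
  rw [sub_zero] at h1
  have h2 : -(‖F' 0‖ * ‖u‖) ≤ ⟪F' 0, u⟫ := (abs_le.1 (abs_real_inner_le_norm _ _)).1
  have h3 : ‖F' 0‖ ^ 2 / μ + μ / 4 * ‖u‖ ^ 2 - ‖F' 0‖ * ‖u‖ =
      (2 * ‖F' 0‖ - μ * ‖u‖) ^ 2 / (4 * μ) := by
    field_simp
    ring
  have h4 : 0 ≤ (2 * ‖F' 0‖ - μ * ‖u‖) ^ 2 / (4 * μ) := by positivity
  linarith

end QuadraticBounds

namespace StructuredSPF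

open scoped RealInnerProductSpace

/-- Nonnegative lower semicontinuous convex functions vanishing at the origin. -/
structure IsConvexGauge {d : ℕ} (p : E d → EReal) : Prop where
  map_zero : p 0 = 0
  nonneg : ∀ x, 0 ≤ p x
  lsc : LowerSemicontinuous p
  convex : IsConvexFun p

variable {d n : ℕ} {p : E d → EReal}

/-! ### Convex gauges and their conjugates -/

namespace IsConvexGauge

lemma ne_bot (hp : IsConvexGauge p) (x : E d) : p x ≠ ⊥ :=
  fun h => by simpa [h] using hp.nonneg x

lemma coe_toReal (hp : IsConvexGauge p) {x : E d} (hx : p x ≠ ⊤) : ((p x).toReal : EReal) = p x :=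
  EReal.coe_toReal hx (hp.ne_bot x)

lemma toReal_nonneg (hp : IsConvexGauge p) (x : E d) : 0 ≤ (p x).toReal :=
  EReal.toReal_nonneg (hp.nonneg x)

lemma toReal_le (hp : IsConvexGauge p) {x : E d} {t : ℝ} (h : p x ≤ t) : (p x).toReal ≤ t := by
  rw [← EReal.coe_le_coe_iff, hp.coe_toReal (ne_top_of_le_ne_top (EReal.coe_ne_top t) h)]
  exact h

lemma isClosed_epigraph (hp : IsConvexGauge p) : IsClosed {q : E d × ℝ | p q.1 ≤ (q.2 : EReal)} :=
  hp.lsc.isClosed_epigraph.preimage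
    (continuous_fst.prodMk (continuous_coe_real_ereal.comp continuous_snd))

lemma nonneg_of_mem_epigraph (hp : IsConvexGauge p) {q : E d × ℝ} (hq : p q.1 ≤ (q.2 : EReal)) :
    0 ≤ q.2 := by
  have := (hp.nonneg q.1).trans hq
  exact_mod_cast this

lemma conj_term (hp : IsConvexGauge p) {x : E d} (hx : p x ≠ ⊤) (y : E d) :
    ((⟪y, x⟫ : ℝ) : EReal) - p x = ((⟪y, x⟫ - (p x).toReal : ℝ) : EReal) := by
  rw [EReal.coe_sub, hp.coe_toReal hx]

/-- The class is stable under conjugation, so the prox theory below serves both φ and its conjugate,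
and no biconjugation is needed. -/
lemma conj (hp : IsConvexGauge p) : IsConvexGauge (conj p) where
  map_zero := by
    refine le_antisymm (iSup_le fun x => ?_) ?_
    · rw [inner_zero_left, EReal.coe_zero, zero_sub]
      simpa using hp.nonneg x
    · refine le_trans ?_ (le_iSup _ (0 : E d))
      simp [hp.map_zero]
  nonneg y := by
    refine le_trans ?_ (le_iSup _ (0 : E d))
    simp [hp.map_zero]
  lsc := by
    refine lowerSemicontinuous_iSup fun x => ?_
    by_cases hx : p x = ⊤
    · simp only [hx, EReal.sub_top]
      exact lowerSemicontinuous_const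
    · simp only [hp.conj_term hx]
      refine Continuous.lowerSemicontinuous ?_
      exact continuous_coe_real_ereal.comp (by fun_prop)
  convex := by
    have : {q : E d × ℝ | StructuredSPF.conj p q.1 ≤ (q.2 : EReal)} =
        ⋂ (x : E d) (_ : p x ≠ ⊤), {q : E d × ℝ | ⟪q.1, x⟫ - q.2 ≤ (p x).toReal} := by
      ext q
      simp only [StructuredSPF.conj, iSup_le_iff, Set.mem_ofPred_eq, Set.mem_iInter]
      refine forall_congr' fun x => ?_
      by_cases hx : p x = ⊤
      · simp [hx]
      · simp only [hp.conj_term hx, EReal.coe_le_coe_iff, ne_eq, hx, not_false_eq_true,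
          forall_const]
        constructor <;> intro h <;> linarith
    unfold IsConvexFun
    rw [this]
    refine convex_iInter fun x => convex_iInter fun _ => convex_halfSpace_le ?_ _
    constructor
    · intro a b
      simp only [Prod.fst_add, Prod.snd_add, inner_add_left]
      ring
    · intro c a
      simp only [Prod.smul_fst, Prod.smul_snd, inner_smul_left, conj_trivial, smul_eq_mul]
      ring

/-- The Fenchel-Young inequality. -/
lemma inner_sub_le_conj (hp : IsConvexGauge p) {x y : E d} (hx : p x ≠ ⊤)
    (hy : StructuredSPF.conj p y ≠ ⊤) :
    ⟪y, x⟫ - (p x).toReal ≤ (StructuredSPF.conj p y).toReal := by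
  rw [← EReal.coe_le_coe_iff, hp.conj.coe_toReal hy, ← hp.conj_term hx]
  exact le_iSup (fun x : E d => ((⟪y, x⟫ : ℝ) : EReal) - p x) x

/-- The equality case of the Fenchel-Young inequality. -/
lemma conj_eq (hp : IsConvexGauge p) {w s : E d} (hw : p w ≠ ⊤)
    (hs : ∀ u, p u ≠ ⊤ → (p w).toReal + ⟪s, u - w⟫ ≤ (p u).toReal) :
    StructuredSPF.conj p s = ((⟪s, w⟫ - (p w).toReal : ℝ) : EReal) := by
  refine le_antisymm (iSup_le fun u => ?_) ?_
  · by_cases hu : p u = ⊤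
    · simp only [hu, EReal.sub_top, bot_le]
    · rw [hp.conj_term hu, EReal.coe_le_coe_iff]
      have := hs u hu
      rw [inner_sub_right] at this
      linarith
  · rw [← hp.conj_term hw]
    exact le_iSup (fun x : E d => ((⟪s, x⟫ : ℝ) : EReal) - p x) w

end IsConvexGauge

lemma IsSPF.isConvexGauge {φ : E d → EReal} (hφ : IsSPF φ) (hc : IsConvexFun φ) :
    IsConvexGauge φ :=
  ⟨hφ.map_zero, hφ.nonneg, hφ.gamma.lsc, hc⟩

/-! ### Proximity operators and Moreau envelopes -/

section Prox

variable {γ : ℝ} {v w : E d}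

lemma IsConvexGauge.prox_objective (hp : IsConvexGauge p) {u : E d} (hu : p u ≠ ⊤) :
    p u + ((1 / (2 * γ) * ‖u - v‖ ^ 2 : ℝ) : EReal) =
      (((p u).toReal + 1 / (2 * γ) * ‖u - v‖ ^ 2 : ℝ) : EReal) := by
  rw [EReal.coe_add, hp.coe_toReal hu]

lemma norm_add_smul_sub_sq (v w e : E d) (θ : ℝ) :
    ‖w + θ • e - v‖ ^ 2 = ‖w - v‖ ^ 2 + 2 * θ * ⟪w - v, e⟫ + θ ^ 2 * ‖e‖ ^ 2 := by
  rw [add_sub_right_comm, norm_add_sq_real, inner_smul_right, norm_smul, mul_pow,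
    Real.norm_eq_abs, sq_abs]
  ring

/-- The variational characterization of the proximity operator. -/
lemma IsConvexGauge.mem_prox_iff (hp : IsConvexGauge p) (hγ : 0 < γ) :
    w ∈ prox γ p v ↔ p w ≠ ⊤ ∧
      ∀ u, p u ≠ ⊤ → (p w).toReal + ⟪γ⁻¹ • (v - w), u - w⟫ ≤ (p u).toReal := by
  constructor
  · intro hw
    have hw' : ∀ u, p w + ((1 / (2 * γ) * ‖w - v‖ ^ 2 : ℝ) : EReal) ≤
        p u + ((1 / (2 * γ) * ‖u - v‖ ^ 2 : ℝ) : EReal) := fun u => hw (Set.mem_univ u)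
    have hwt : p w ≠ ⊤ := by
      intro h
      have h0 := hw' 0
      rw [h, hp.map_zero, zero_add, EReal.top_add_coe, top_le_iff] at h0
      exact EReal.coe_ne_top _ h0
    refine ⟨hwt, fun u hu => ?_⟩
    have hmin : ∀ r ∈ {q : E d × ℝ | p q.1 ≤ (q.2 : EReal)},
        1 / (2 * γ) * ‖w - v‖ ^ 2 + (p w).toReal ≤ 1 / (2 * γ) * ‖r.1 - v‖ ^ 2 + r.2 := by
      intro r hr
      have h1 := hw' r.1
      have hrt : p r.1 ≠ ⊤ := ne_top_of_le_ne_top (EReal.coe_ne_top r.2) hr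
      rw [hp.prox_objective hwt, hp.prox_objective hrt, EReal.coe_le_coe_iff] at h1
      have h2 := hp.toReal_le hr
      linarith
    have h := le_add_of_forall_add_le (h := fun u => 1 / (2 * γ) * ‖u - v‖ ^ 2)
      (q := (w, (p w).toReal)) (r := (u, (p u).toReal)) (m := γ⁻¹ * ⟪w - v, u - w⟫)
      (c := 1 / (2 * γ) * ‖u - w‖ ^ 2) hp.convex (hp.coe_toReal hwt).ge (hp.coe_toReal hu).ge hmin
      (fun θ => by
        simp only [norm_add_smul_sub_sq]
        apply le_of_eq
        field_simp)
    rw [inner_smul_left, ← neg_sub w v, inner_neg_left, conj_trivial]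
    simp only at h
    linarith
  · rintro ⟨hwt, hw⟩ u -
    simp only [Set.mem_ofPred_eq]
    by_cases hu : p u = ⊤
    · rw [hu, EReal.top_add_coe]
      exact le_top
    · rw [hp.prox_objective hwt, hp.prox_objective hu, EReal.coe_le_coe_iff]
      have h1 := hw u hu
      have h2 := norm_add_smul_sub_sq v w (u - w) 1
      rw [one_smul, add_sub_cancel] at h2
      rw [inner_smul_left, ← neg_sub w v, inner_neg_left, conj_trivial] at h1
      have h3 : 1 / (2 * γ) * ‖u - v‖ ^ 2 = 1 / (2 * γ) * ‖w - v‖ ^ 2 + γ⁻¹ * ⟪w - v, u - w⟫ +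
          1 / (2 * γ) * ‖u - w‖ ^ 2 := by
        rw [h2]
        field_simp
      have h4 : 0 ≤ 1 / (2 * γ) * ‖u - w‖ ^ 2 := by positivity
      linarith

lemma IsConvexGauge.prox_nonempty (hp : IsConvexGauge p) (hγ : 0 < γ) (v : E d) :
    (prox γ p v).Nonempty := by
  have hcont : Continuous fun u : E d => 1 / (2 * γ) * ‖u - v‖ ^ 2 := by fun_prop
  obtain ⟨⟨w, t⟩, hq, hmin⟩ := exists_forall_add_le hp.isClosed_epigraph
    (fun q hq => hp.nonneg_of_mem_epigraph hq) ⟨((0 : E d), (0 : ℝ)), by simp [hp.map_zero]⟩ hcont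
    (m := 0) (fun u => by positivity) (fun c => by
      refine (Metric.isBounded_closedBall (x := v) (r := √(2 * γ * c))).subset fun u hu => ?_
      rw [Metric.mem_closedBall, dist_eq_norm]
      refine Real.le_sqrt_of_sq_le ?_
      have h1 : 1 / (2 * γ) * ‖u - v‖ ^ 2 ≤ c := hu
      rw [one_div, inv_mul_le_iff₀ (by positivity)] at h1
      exact h1)
  refine ⟨w, fun u _ => ?_⟩
  simp only [Set.mem_ofPred_eq] at hq ⊢
  by_cases hu : p u = ⊤
  · rw [hu, EReal.top_add_coe]
    exact le_top
  · have hwt : p w ≠ ⊤ := ne_top_of_le_ne_top (EReal.coe_ne_top t) hq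
    rw [hp.prox_objective hwt, hp.prox_objective hu, EReal.coe_le_coe_iff]
    have h1 := hmin (u, (p u).toReal) (hp.coe_toReal hu).ge
    have h2 := hp.toReal_le hq
    simp only at h1
    linarith

lemma IsConvexGauge.prox_unique (hp : IsConvexGauge p) (hγ : 0 < γ) {w' : E d}
    (hw : w ∈ prox γ p v) (hw' : w' ∈ prox γ p v) : w = w' := by
  rw [hp.mem_prox_iff hγ] at hw hw'
  have h1 := hw.2 w' hw'.1
  have h2 := hw'.2 w hw.1
  have h3 : ⟪γ⁻¹ • (v - w), w' - w⟫ + ⟪γ⁻¹ • (v - w'), w - w'⟫ = γ⁻¹ * ‖w' - w‖ ^ 2 := by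
    rw [← neg_sub w' w, inner_neg_right, ← sub_eq_add_neg, ← inner_sub_left, ← smul_sub,
      sub_sub_sub_cancel_left, inner_smul_left, real_inner_self_eq_norm_sq, conj_trivial]
  have h4 : γ⁻¹ * ‖w' - w‖ ^ 2 ≤ 0 := by linarith
  have h5 : ‖w' - w‖ ^ 2 ≤ 0 := nonpos_of_mul_nonpos_right h4 (inv_pos.2 hγ)
  have h6 : ‖w' - w‖ = 0 := pow_eq_zero_iff two_ne_zero |>.1 (le_antisymm h5 (sq_nonneg _))
  exact (sub_eq_zero.1 (norm_eq_zero.1 h6)).symm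

/-- Moreau's decomposition. -/
lemma IsConvexGauge.smul_sub_mem_prox_conj (hp : IsConvexGauge p) (hγ : 0 < γ)
    (hw : w ∈ prox γ p v) : γ⁻¹ • (v - w) ∈ prox γ⁻¹ (StructuredSPF.conj p) (γ⁻¹ • v) := by
  rw [hp.mem_prox_iff hγ] at hw
  rw [hp.conj.mem_prox_iff (inv_pos.2 hγ)]
  -- The vector γ⁻¹ • (v - w) is a subgradient at w, so Fenchel-Young is an equality there; its
  -- inequality at other dual points is the condition sought.
  have h1 := hp.conj_eq hw.1 hw.2
  refine ⟨by rw [h1]; exact EReal.coe_ne_top _, fun u hu => ?_⟩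
  have h2 := hp.inner_sub_le_conj hw.1 hu
  have h3 : (γ⁻¹)⁻¹ • (γ⁻¹ • v - γ⁻¹ • (v - w)) = w := by
    rw [← smul_sub, sub_sub_cancel, smul_smul, inv_inv, mul_inv_cancel₀ hγ.ne', one_smul]
  rw [h1, h3, EReal.toReal_coe, inner_sub_right, real_inner_comm u w,
    real_inner_comm (γ⁻¹ • (v - w)) w]
  linarith

lemma IsConvexGauge.env_eq (hp : IsConvexGauge p) (hγ : 0 < γ) (hw : w ∈ prox γ p v) :
    env γ p v = (((p w).toReal + 1 / (2 * γ) * ‖w - v‖ ^ 2 : ℝ) : EReal) := by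
  rw [← hp.prox_objective ((hp.mem_prox_iff hγ).1 hw).1]
  exact le_antisymm (iInf_le _ w) (le_iInf fun u => hw (Set.mem_univ u))

/-- The Moreau envelope is convex and smooth, with gradient `γ⁻¹ • (v - w)` at `v`. -/
lemma IsConvexGauge.env_bounds (hp : IsConvexGauge p) (hγ : 0 < γ) {v' : E d}
    (hw : w ∈ prox γ p v) :
    (env γ p v).toReal + ⟪γ⁻¹ • (v - w), v' - v⟫ ≤ (env γ p v').toReal ∧
      (env γ p v').toReal ≤
        (env γ p v).toReal + ⟪γ⁻¹ • (v - w), v' - v⟫ + 1 / (2 * γ) * ‖v' - v‖ ^ 2 := by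
  obtain ⟨w', hw'⟩ := hp.prox_nonempty hγ v'
  rw [hp.env_eq hγ hw, hp.env_eq hγ hw', EReal.toReal_coe, EReal.toReal_coe]
  have h1 := ((hp.mem_prox_iff hγ).1 hw).1
  have h1' := ((hp.mem_prox_iff hγ).1 hw').1
  have h2 := ((hp.mem_prox_iff hγ).1 hw).2 w' h1'
  have h3 := hw' (Set.mem_univ w)
  simp only [Set.mem_ofPred_eq] at h3
  rw [hp.prox_objective h1, hp.prox_objective h1', EReal.coe_le_coe_iff] at h3
  have hc : 0 < 1 / (2 * γ) := by positivity
  have hc2 : γ⁻¹ = 2 * (1 / (2 * γ)) := by field_simp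
  rw [hc2] at h2 ⊢
  obtain ⟨a, ha⟩ : ∃ a, a = v - w := ⟨_, rfl⟩
  obtain ⟨b, hb⟩ : ∃ b, b = v' - w' := ⟨_, rfl⟩
  obtain ⟨e, he⟩ : ∃ e, e = v' - v := ⟨_, rfl⟩
  have e1 : w' - w = e + a - b := by rw [ha, hb, he]; abel
  have e2 : w - v = -a := by rw [ha]; abel
  have e3 : w' - v' = -b := by rw [hb]; abel
  have e4 : w - v' = -(a + e) := by rw [ha, he]; abel
  rw [e1, ← ha] at h2
  rw [e3, e4, norm_neg, norm_neg, norm_add_sq_real] at h3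
  rw [e2, e3, ← ha, ← he, norm_neg, norm_neg]
  simp only [inner_smul_left, inner_sub_right, inner_add_right, real_inner_self_eq_norm_sq,
    conj_trivial] at *
  constructor
  -- The subgradient inequality at w leaves exactly this square as slack. The upper bound only uses
  -- w as a competitor for v'.
  · have h4 : 0 ≤ 1 / (2 * γ) * ‖a - b‖ ^ 2 := by positivity
    rw [norm_sub_sq_real] at h4
    linarith
  · linarith

end Prox

/-! ### Projections as proximity operators of indicators -/

section Projection

variable {C : Set (E d)} {v w : E d}

lemma norm_sub_eq_iInf_iff (hw : w ∈ C) :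
    ‖v - w‖ = ⨅ u : C, ‖v - u‖ ↔ ∀ u ∈ C, ‖w - v‖ ≤ ‖u - v‖ := by
  have hne : Nonempty C := ⟨⟨w, hw⟩⟩
  have hbdd : BddBelow (Set.range fun u : C => ‖v - u‖) := ⟨0, by rintro _ ⟨u, rfl⟩; positivity⟩
  constructor
  · intro h u hu
    rw [norm_sub_rev w, norm_sub_rev u, h]
    exact ciInf_le hbdd ⟨u, hu⟩
  · intro h
    refine le_antisymm (le_ciInf fun u => ?_) (ciInf_le hbdd ⟨w, hw⟩)
    rw [norm_sub_rev v, norm_sub_rev v]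
    exact h u u.2

lemma mem_proj_iff (hC : Convex ℝ C) :
    w ∈ proj C v ↔ w ∈ C ∧ ∀ u ∈ C, ⟪v - w, u - w⟫ ≤ 0 := by
  refine and_congr_right fun hw => ?_
  rw [← norm_eq_iInf_iff_real_inner_le_zero hC hw, norm_sub_eq_iInf_iff hw]

lemma proj_nonempty (hC : IsClosed C) (hCc : Convex ℝ C) (hne : C.Nonempty) (v : E d) :
    (proj C v).Nonempty := by
  obtain ⟨w, hw, h⟩ := exists_norm_eq_iInf_of_complete_convex hne hC.isComplete hCc v
  exact ⟨w, hw, (norm_sub_eq_iInf_iff hw).1 h⟩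

lemma prox_indic {τ : ℝ} (hτ : 0 < τ) (hne : C.Nonempty) (v : E d) :
    prox τ (indic C) v = proj C v := by
  have hc : 0 < 1 / (2 * τ) := by positivity
  have hle : ∀ a b : E d, 1 / (2 * τ) * ‖a - v‖ ^ 2 ≤ 1 / (2 * τ) * ‖b - v‖ ^ 2 ↔
      ‖a - v‖ ≤ ‖b - v‖ := fun a b => by
    rw [mul_le_mul_iff_right₀ hc, pow_le_pow_iff_left₀ (norm_nonneg _) (norm_nonneg _) two_ne_zero]
  ext w
  constructor
  · intro h
    have h' : ∀ u, indic C w + ((1 / (2 * τ) * ‖w - v‖ ^ 2 : ℝ) : EReal) ≤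
        indic C u + ((1 / (2 * τ) * ‖u - v‖ ^ 2 : ℝ) : EReal) := fun u => h (Set.mem_univ u)
    have hw : w ∈ C := by
      by_contra hw
      obtain ⟨u, hu⟩ := hne
      have h1 := h' u
      simp only [indic, hw, hu, if_true, if_false, zero_add, EReal.top_add_coe, top_le_iff] at h1
      exact EReal.coe_ne_top _ h1
    refine ⟨hw, fun u hu => ?_⟩
    have h1 := h' u
    simp only [indic, hw, hu, if_true, zero_add, EReal.coe_le_coe_iff] at h1
    exact (hle w u).1 h1
  · rintro ⟨hw, h⟩ u -
    simp only [Set.mem_ofPred_eq, indic, hw, if_true, zero_add]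
    by_cases hu : u ∈ C
    · simp only [hu, if_true, zero_add, EReal.coe_le_coe_iff]
      exact (hle w u).2 (h u hu)
    · simp only [hu, if_false, EReal.top_add_coe, le_top]

end Projection

end StructuredSPF

namespace StructuredSPF

open scoped RealInnerProductSpace

variable {d n : ℕ}

/-! ### Primal existence and zero duality gap by penalization -/

section Duality

variable {φ : E n → EReal} {F : E d → ℝ} {F' : E d → E d} {μ L : ℝ} {C : Set (E d)}
  {B : E d →L[ℝ] E n}

/-- The penalized problem `min F u + φ w + ‖B u - w‖² / (2 δ)` has a solution, which provides a
dual point whose dual value is at least the penalized minimum. -/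
lemma exists_penalized_solution (hφ : IsConvexGauge φ) (hC : IsClosed C) (hCc : Convex ℝ C)
    (hfeas : ∃ x ∈ C, φ (B x) ≠ ⊤) (hF : HasQuadraticBounds F F' μ L) (hμ : 0 < μ)
    {δ : ℝ} (hδ : 0 < δ) :
    ∃ (x : E d) (w : E n) (v : E n), x ∈ C ∧ φ w ≠ ⊤ ∧
      (∀ u ∈ C, φ (B u) ≠ ⊤ →
        F x + (φ w).toReal + 1 / (2 * δ) * ‖B x - w‖ ^ 2 ≤ F u + (φ (B u)).toReal) ∧
      conj φ v ≠ ⊤ ∧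
      ∀ u ∈ C, F x + (φ w).toReal ≤ lagrangian F (fun v => (conj φ v).toReal) B u v := by
  have hFc : Continuous F := continuous_iff_continuousAt.2 fun x =>
    (hF.hasGradientAt hμ.le x).continuousAt
  set h : E d × E n → ℝ := fun q => F q.1 + 1 / (2 * δ) * ‖B q.1 - q.2‖ ^ 2 with hh
  have hcont : Continuous h := by fun_prop
  set K : Set ((E d × E n) × ℝ) := {q | q.1.1 ∈ C ∧ φ q.1.2 ≤ (q.2 : EReal)} with hK
  have hKc : IsClosed K := by
    refine IsClosed.inter (hC.preimage (by fun_prop)) ?_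
    exact hφ.isClosed_epigraph.preimage
      (f := fun q : (E d × E n) × ℝ => (q.1.2, q.2)) (by fun_prop)
  have hKconv : Convex ℝ K := by
    rintro q ⟨hq1, hq2⟩ r ⟨hr1, hr2⟩ a b ha hb hab
    exact ⟨hCc hq1 hr1 ha hb hab,
      hφ.convex (x := (q.1.2, q.2)) hq2 (y := (r.1.2, r.2)) hr2 ha hb hab⟩
  obtain ⟨x₀, hx₀, hx₀'⟩ := hfeas
  set m := F 0 - ‖F' 0‖ ^ 2 / μ with hm
  have hlow : ∀ q : E d × E n,
      m + μ / 4 * ‖q.1‖ ^ 2 + 1 / (2 * δ) * ‖B q.1 - q.2‖ ^ 2 ≤ h q := fun q => by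
    have := hF.add_norm_sq_le_apply hμ q.1
    simp only [hh]
    linarith
  obtain ⟨⟨⟨x, w⟩, t⟩, ⟨hx, hwt⟩, hmin⟩ := exists_forall_add_le hKc
    (fun q hq => hφ.nonneg_of_mem_epigraph (q := (q.1.2, q.2)) hq.2)
    ⟨((x₀, B x₀), (φ (B x₀)).toReal), hx₀, (hφ.coe_toReal hx₀').ge⟩ hcont (m := m)
    (fun q => by
      have h1 : 0 ≤ μ / 4 * ‖q.1‖ ^ 2 := by positivity
      have h2 : 0 ≤ 1 / (2 * δ) * ‖B q.1 - q.2‖ ^ 2 := by positivity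
      linarith [hlow q])
    (fun c => by
      set r := √(4 / μ * (c - m)) with hr
      set s := √(2 * δ * (c - m)) with hs
      refine (isBounded_iff_forall_norm_le.2 ⟨max r (‖B‖ * r + s), ?_⟩)
      rintro ⟨u, v⟩ huv
      have h0 : h (u, v) ≤ c := huv
      have h1 : 0 ≤ μ / 4 * ‖u‖ ^ 2 := by positivity
      have h2 : 0 ≤ 1 / (2 * δ) * ‖B u - v‖ ^ 2 := by positivity
      have h3 := hlow (u, v)
      simp only at h3
      have hur : ‖u‖ ≤ r := by
        refine Real.le_sqrt_of_sq_le ?_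
        have h4 : μ / 4 * ‖u‖ ^ 2 ≤ c - m := by linarith
        calc ‖u‖ ^ 2 = 4 / μ * (μ / 4 * ‖u‖ ^ 2) := by field_simp
          _ ≤ _ := mul_le_mul_of_nonneg_left h4 (by positivity)
      have hvs : ‖B u - v‖ ≤ s := by
        refine Real.le_sqrt_of_sq_le ?_
        have h4 : 1 / (2 * δ) * ‖B u - v‖ ^ 2 ≤ c - m := by linarith
        calc ‖B u - v‖ ^ 2 = 2 * δ * (1 / (2 * δ) * ‖B u - v‖ ^ 2) := by field_simp
          _ ≤ _ := mul_le_mul_of_nonneg_left h4 (by positivity)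
      refine norm_prod_le_iff.2 ⟨hur.trans (le_max_left _ _), le_trans ?_ (le_max_right _ _)⟩
      have h5 : ‖v‖ ≤ ‖B u‖ + ‖B u - v‖ := by
        have := norm_sub_le (B u) (B u - v)
        rwa [sub_sub_cancel] at this
      have h6 := B.le_opNorm_of_le hur
      exact h5.trans (add_le_add h6 hvs))
  simp only at hx hwt
  have hw : φ w ≠ ⊤ := ne_top_of_le_ne_top (EReal.coe_ne_top t) hwt
  have hwt' : (φ w).toReal ≤ t := hφ.toReal_le hwt
  have hmin' : ∀ r ∈ K, h (x, w) + (φ w).toReal ≤ h r.1 + r.2 := fun r hr => by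
    have := hmin r hr
    simp only at this
    linarith
  have hmem : ((x, w), (φ w).toReal) ∈ K := ⟨hx, (hφ.coe_toReal hw).ge⟩
  -- The gradient of the penalty plays the role of the multiplier for w = B u; varying u and w
  -- separately gives the two optimality conditions.
  set v := δ⁻¹ • (B x - w) with hv
  have hexp : ∀ (e : E d) (f : E n) (θ : ℝ), h ((x, w) + θ • (e, f)) ≤
      h (x, w) + θ * (⟪F' x, e⟫ + ⟪v, B e - f⟫) +
        θ ^ 2 * (L / 2 * ‖e‖ ^ 2 + 1 / (2 * δ) * ‖B e - f‖ ^ 2) := by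
    intro e f θ
    have h1 := hF.upper x (x + θ • e)
    rw [add_sub_cancel_left, inner_smul_right, norm_smul, mul_pow, Real.norm_eq_abs, sq_abs] at h1
    have e1 : B (x + θ • e) - (w + θ • f) = (B x - w) + θ • (B e - f) := by
      rw [map_add, map_smul]; module
    have e2 : 1 / (2 * δ) * ‖B (x + θ • e) - (w + θ • f)‖ ^ 2 = 1 / (2 * δ) * ‖B x - w‖ ^ 2 +
        θ * ⟪v, B e - f⟫ + θ ^ 2 * (1 / (2 * δ) * ‖B e - f‖ ^ 2) := by
      rw [e1, norm_add_sq_real, inner_smul_right, norm_smul, mul_pow, Real.norm_eq_abs, sq_abs, hv,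
        inner_smul_left, conj_trivial]
      field_simp
    simp only [hh, Prod.fst_add, Prod.snd_add, Prod.smul_fst, Prod.smul_snd]
    rw [e2]
    linarith
  have hprimal : ∀ u ∈ C, 0 ≤ ⟪F' x, u - x⟫ + ⟪v, B (u - x)⟫ := by
    intro u hu
    have := le_add_of_forall_add_le hKconv (h := h) (r := ((u, w), (φ w).toReal)) hmem
      ⟨hu, (hφ.coe_toReal hw).ge⟩ hmin' (fun θ => by
        have := hexp (u - x) 0 θ
        simpa only [Prod.mk_sub_mk, sub_self] using this)
    simp only [sub_zero] at this
    linarith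
  have hdual : ∀ u, φ u ≠ ⊤ → (φ w).toReal + ⟪v, u - w⟫ ≤ (φ u).toReal := by
    intro u hu
    have := le_add_of_forall_add_le hKconv (h := h) (r := ((x, u), (φ u).toReal)) hmem
      ⟨hx, (hφ.coe_toReal hu).ge⟩ hmin' (fun θ => by
        have := hexp 0 (u - w) θ
        simpa only [Prod.mk_sub_mk, sub_self] using this)
    simp only [inner_zero_right, map_zero, zero_sub, inner_neg_right, zero_add] at this
    linarith
  have hconj := hφ.conj_eq hw hdual
  refine ⟨x, w, v, hx, hw, fun u hu hu' => ?_, by rw [hconj]; exact EReal.coe_ne_top _,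
    fun u hu => ?_⟩
  · have := hmin' ((u, B u), (φ (B u)).toReal) ⟨hu, (hφ.coe_toReal hu').ge⟩
    simp only [hh, sub_self, norm_zero] at this
    linarith
  · have h1 := hF.lower x u
    have h2 := hprimal u hu
    have h3 : 0 ≤ μ / 2 * ‖u - x‖ ^ 2 := by positivity
    -- The mismatch between B x and w only raises the dual value.
    have h4 : 0 ≤ ⟪v, B x - w⟫ := by
      rw [hv, inner_smul_left, real_inner_self_eq_norm_sq, conj_trivial]
      positivity
    rw [map_sub, inner_sub_right v] at h2
    rw [inner_sub_right] at h4
    simp only [lagrangian]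
    rw [hconj, EReal.toReal_coe, real_inner_comm]
    linarith

/-- Existence of a minimizer of `F + φ ∘ B` over `C` and absence of a duality gap. The dual
supremum need not be attained. -/
lemma exists_solution_and_dual (hφ : IsConvexGauge φ) (hC : IsClosed C) (hCc : Convex ℝ C)
    (hfeas : ∃ x ∈ C, φ (B x) ≠ ⊤) (hF : HasQuadraticBounds F F' μ L) (hμ : 0 < μ) :
    ∃ xs ∈ C, φ (B xs) ≠ ⊤ ∧
      (∀ u ∈ C, φ (B u) ≠ ⊤ → F xs + (φ (B xs)).toReal ≤ F u + (φ (B u)).toReal) ∧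
      ∀ ε > 0, ∃ v, conj φ v ≠ ⊤ ∧ ∀ u ∈ C, F xs + (φ (B xs)).toReal - ε ≤
        lagrangian F (fun v => (conj φ v).toReal) B u v := by
  have hFc : Continuous F := continuous_iff_continuousAt.2 fun x =>
    (hF.hasGradientAt hμ.le x).continuousAt
  have hδ : ∀ k : ℕ, (0 : ℝ) < 1 / ((k : ℝ) + 1) := fun k => Nat.one_div_pos_of_nat
  choose x w v hx hw hmin hv hlag using fun k : ℕ =>
    exists_penalized_solution hφ hC hCc hfeas hF hμ (hδ k)
  obtain ⟨x₀, hx₀, hx₀'⟩ := hfeas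
  set M := F x₀ + (φ (B x₀)).toReal - (F 0 - ‖F' 0‖ ^ 2 / μ) with hM
  have hbound : ∀ k, μ / 4 * ‖x k‖ ^ 2 + (φ (w k)).toReal +
      1 / (2 * (1 / ((k : ℝ) + 1))) * ‖B (x k) - w k‖ ^ 2 ≤ M := fun k => by
    have h1 := hmin k x₀ hx₀ hx₀'
    have h2 := hF.add_norm_sq_le_apply hμ (x k)
    rw [hM]
    linarith
  have ht0 : ∀ k, 0 ≤ (φ (w k)).toReal := fun k => hφ.toReal_nonneg _
  have hgap0 : ∀ k : ℕ, 0 ≤ 1 / (2 * (1 / ((k : ℝ) + 1))) * ‖B (x k) - w k‖ ^ 2 := fun k => by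
    have := hδ k
    positivity
  have hx2 : ∀ k, x k ∈ Metric.closedBall (0 : E d) (√(4 / μ * M)) := fun k => by
    rw [mem_closedBall_zero_iff]
    refine Real.le_sqrt_of_sq_le ?_
    have h4 : μ / 4 * ‖x k‖ ^ 2 ≤ M := by linarith [hbound k, ht0 k, hgap0 k]
    calc ‖x k‖ ^ 2 = 4 / μ * (μ / 4 * ‖x k‖ ^ 2) := by field_simp
      _ ≤ _ := mul_le_mul_of_nonneg_left h4 (by positivity)
  have hxn : ∀ k, 0 ≤ μ / 4 * ‖x k‖ ^ 2 := fun k => by positivity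
  have ht2 : ∀ k, (φ (w k)).toReal ∈ Set.Icc 0 M := fun k =>
    ⟨ht0 k, by linarith [hbound k, hxn k, hgap0 k]⟩
  -- The values φ (w k) are extracted along with x k, so that the closed epigraph gives φ (B xs) ≤
  -- ts in the limit.
  obtain ⟨⟨xs, ts⟩, -, f, hf, hlim⟩ :=
    ((isCompact_closedBall (0 : E d) (√(4 / μ * M))).prod
      (isCompact_Icc (a := (0 : ℝ)) (b := M))).tendsto_subseq
      (x := fun k => (x k, (φ (w k)).toReal)) fun k => ⟨hx2 k, ht2 k⟩
  have hxlim : Tendsto (fun k => x (f k)) atTop (𝓝 xs) := (continuous_fst.tendsto _).comp hlim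
  have htlim : Tendsto (fun k => (φ (w (f k))).toReal) atTop (𝓝 ts) :=
    (continuous_snd.tendsto _).comp hlim
  have hgap : Tendsto (fun k => B (x k) - w k) atTop (𝓝 0) := by
    have h1 : Tendsto (fun k : ℕ => 2 * (1 / ((k : ℝ) + 1)) * M) atTop (𝓝 0) := by
      simpa using (tendsto_one_div_add_atTop_nhds_zero_nat (𝕜 := ℝ)).const_mul 2 |>.mul_const M
    have h2 : Tendsto (fun k => ‖B (x k) - w k‖ ^ 2) atTop (𝓝 0) := by
      refine squeeze_zero (fun _ => sq_nonneg _) (fun k => ?_) h1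
      have h3 : 1 / (2 * (1 / ((k : ℝ) + 1))) * ‖B (x k) - w k‖ ^ 2 ≤ M := by
        linarith [hbound k, hxn k, ht0 k]
      have h4 := hδ k
      rwa [one_div, inv_mul_le_iff₀ (by positivity)] at h3
    rw [tendsto_zero_iff_norm_tendsto_zero]
    simpa [Real.sqrt_sq (norm_nonneg _)] using h2.sqrt
  have hwlim : Tendsto (fun k => w (f k)) atTop (𝓝 (B xs)) := by
    have h1 := ((B.continuous.tendsto xs).comp hxlim).sub (hgap.comp hf.tendsto_atTop)
    simpa using h1
  have hxsC : xs ∈ C := hC.mem_of_tendsto hxlim (Eventually.of_forall fun k => hx _)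
  have hts : φ (B xs) ≤ (ts : EReal) :=
    hφ.isClosed_epigraph.mem_of_tendsto (hwlim.prodMk_nhds htlim)
      (Eventually.of_forall fun k => (hφ.coe_toReal (hw (f k))).ge)
  have hval : Tendsto (fun k => F (x (f k)) + (φ (w (f k))).toReal) atTop (𝓝 (F xs + ts)) :=
    ((hFc.tendsto xs).comp hxlim).add htlim
  have hts' := hφ.toReal_le hts
  refine ⟨xs, hxsC, ne_top_of_le_ne_top (EReal.coe_ne_top ts) hts, fun u hu hu' => ?_,
    fun ε hε => ?_⟩
  · have : F xs + ts ≤ F u + (φ (B u)).toReal :=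
      le_of_tendsto hval (Eventually.of_forall fun k => by
        linarith [hmin (f k) u hu hu', hgap0 (f k)])
    linarith
  -- Penalized values approach F xs + ts, which is at least the primal value at xs, so one
  -- multiplier far along the subsequence suffices.
  · obtain ⟨k, hk⟩ := (hval.eventually_const_lt (show F xs + ts - ε < F xs + ts by linarith)).exists
    exact ⟨v (f k), hv _, fun u hu => by linarith [hlag (f k) u hu]⟩

end Duality

/-! ### The structured problem and Algorithm 1 -/

section Main

variable {φ : E n → EReal} {C : Set (E d)} {B : E d →L[ℝ] E n} {z : E d} {lam α τ σ ρ : ℝ}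

/-- The quadratic has modulus 1/λ on both sides. Smoothness of the envelope costs ‖B‖²/α of the
lower modulus; its convexity leaves the upper one intact. -/
lemma hasQuadraticBounds_smoothPart (hφ : IsConvexGauge φ) (hlam : 0 < lam) (hα : 0 < α)
    (B : E d →L[ℝ] E n) (z : E d) {q : E d → E n}
    (hq : ∀ x, q x ∈ prox α⁻¹ (conj φ) (α⁻¹ • B x)) :
    HasQuadraticBounds (smoothPart φ α lam B z)
      (fun x => (1 / lam) • (x - z) - B.adjoint (q x)) (1 / lam - ‖B‖ ^ 2 / α) (1 / lam) := by
  have hsq : ∀ x u : E d, 1 / (2 * lam) * ‖u - z‖ ^ 2 = 1 / (2 * lam) * ‖x - z‖ ^ 2 +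
      ⟪(1 / lam) • (x - z), u - x⟫ + 1 / lam / 2 * ‖u - x‖ ^ 2 := by
    intro x u
    have h2 := norm_add_smul_sub_sq z x (u - x) 1
    rw [one_smul, add_sub_cancel] at h2
    rw [h2, inner_smul_left, conj_trivial]
    field_simp
  have henv : ∀ x u : E d,
      (env α φ (B x)).toReal + ⟪q x, B (u - x)⟫ ≤ (env α φ (B u)).toReal ∧
        (env α φ (B u)).toReal ≤ (env α φ (B x)).toReal + ⟪q x, B (u - x)⟫ +
          1 / (2 * α) * ‖B (u - x)‖ ^ 2 := by
    intro x u
    obtain ⟨w, hw⟩ := hφ.prox_nonempty hα (B x)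
    have := hφ.env_bounds hα (v' := B u) hw
    rwa [hφ.conj.prox_unique (inv_pos.2 hα) (hφ.smul_sub_mem_prox_conj hα hw) (hq x),
      ← map_sub] at this
  constructor
  · intro x u
    have h1 := hsq x u
    have h2 := (henv x u).2
    have h3 : 1 / (2 * α) * ‖B (u - x)‖ ^ 2 ≤ ‖B‖ ^ 2 / α / 2 * ‖u - x‖ ^ 2 := by
      have h4 : ‖B (u - x)‖ ^ 2 ≤ (‖B‖ * ‖u - x‖) ^ 2 :=
        pow_le_pow_left₀ (norm_nonneg _) (B.le_opNorm _) 2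
      calc _ ≤ 1 / (2 * α) * (‖B‖ * ‖u - x‖) ^ 2 := mul_le_mul_of_nonneg_left h4 (by positivity)
        _ = _ := by field_simp
    rw [inner_sub_left, ContinuousLinearMap.adjoint_inner_left]
    simp only [smoothPart]
    linarith
  · intro x u
    have h1 := hsq x u
    have h2 := (henv x u).1
    rw [inner_sub_left, ContinuousLinearMap.adjoint_inner_left]
    simp only [smoothPart]
    linarith

/-- The envelope is finite, so it can be moved into the smooth part even where φ is +∞. -/
lemma objective_eq (hφ : IsConvexGauge φ) (hα : 0 < α) (x : E d) :
    objective φ α lam B z x = ((smoothPart φ α lam B z x : ℝ) : EReal) + φ (B x) := by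
  obtain ⟨w, hw⟩ := hφ.prox_nonempty hα (B x)
  simp only [objective, structured, smoothPart]
  rw [hφ.env_eq hα hw, EReal.toReal_coe]
  by_cases h : φ (B x) = ⊤
  · rw [h, EReal.top_sub_coe, EReal.coe_add_top, EReal.coe_add_top]
  · rw [← hφ.coe_toReal h, ← EReal.coe_sub, ← EReal.coe_add, ← EReal.coe_add]
    congr 1
    ring

lemma add_smul_sub_eq {V : Type*} [AddCommGroup V] [Module ℝ V] (ρ : ℝ) (a b : V) :
    ρ • a + (1 - ρ) • b = b + ρ • (a - b) := by module

lemma exists_isPDRun (hφ : IsConvexGauge φ) (hC : IsClosed C) (hCc : Convex ℝ C)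
    (hne : C.Nonempty) (hα : 0 < α) (hσ : 0 < σ) (x₀ : E d) (y₀ : E n) :
    ∃ (x : ℕ → E d) (y : ℕ → E n), x 0 = x₀ ∧ y 0 = y₀ ∧ IsPDRun φ C α lam B z τ σ ρ x y := by
  choose q hq using fun x : E d => hφ.conj.prox_nonempty (inv_pos.2 hα) (α⁻¹ • B x)
  choose P hP using fun v : E d => proj_nonempty hC hCc hne v
  choose R hR using fun v : E n => hφ.conj.prox_nonempty hσ v
  set X : E d × E n → E d := fun s =>
    P (s.1 - τ • ((1 / lam) • (s.1 - z)) + τ • B.adjoint (q s.1 - s.2)) with hX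
  set Y : E d × E n → E n := fun s => R (s.2 + σ • B ((2 : ℝ) • X s - s.1)) with hY
  set S : ℕ → E d × E n := fun k => Nat.rec (x₀, y₀)
    (fun _ s => (ρ • X s + (1 - ρ) • s.1, ρ • Y s + (1 - ρ) • s.2)) k with hS
  exact ⟨fun k => (S k).1, fun k => (S k).2, rfl, rfl, fun k =>
    ⟨X (S k), Y (S k), q (S k).1, hq _, hP _, hR _, rfl, rfl⟩⟩

lemma isPDRun_iff_isCondatRun (hφ : IsConvexGauge φ) (hne : C.Nonempty) (hα : 0 < α) (hτ : 0 < τ)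
    (hgrad : ∀ (x : E d), ∀ q ∈ prox α⁻¹ (conj φ) (α⁻¹ • B x),
      gradient (smoothPart φ α lam B z) x = (1 / lam) • (x - z) - B.adjoint q)
    (x : ℕ → E d) (y : ℕ → E n) :
    IsPDRun φ C α lam B z τ σ ρ x y ↔
      IsCondatRun (smoothPart φ α lam B z) (indic C) φ B τ σ ρ x y := by
  have harg : ∀ k, ∀ q ∈ prox α⁻¹ (conj φ) (α⁻¹ • B (x k)),
      x k - τ • gradient (smoothPart φ α lam B z) (x k) - τ • B.adjoint (y k) =
        x k - τ • ((1 / lam) • (x k - z)) + τ • B.adjoint (q - y k) := by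
    intro k q hq
    rw [hgrad _ q hq, map_sub]
    module
  refine forall_congr' fun k => ?_
  constructor
  · rintro ⟨xt, yt, q, hq, h1, h2⟩
    exact ⟨xt, yt, by rwa [prox_indic hτ hne, harg k q hq], h2⟩
  · rintro ⟨xt, yt, h1, h2⟩
    obtain ⟨q, hq⟩ := hφ.conj.prox_nonempty (inv_pos.2 hα) (α⁻¹ • B (x k))
    exact ⟨xt, yt, q, hq, by rwa [prox_indic hτ hne, harg k q hq] at h1, h2⟩

/-- The steps of the algorithm satisfy the optimality conditions of a primal-dual step. -/
lemma isPrimalDualStep_of_mem (hφ : IsConvexGauge φ) (hCc : Convex ℝ C) (hτ : 0 < τ) (hσ : 0 < σ)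
    {F' : E d → E d} {x xt : E d} {y yt q : E n}
    (hF' : F' x = (1 / lam) • (x - z) - B.adjoint q)
    (hxt : xt ∈ proj C (x - τ • ((1 / lam) • (x - z)) + τ • B.adjoint (q - y)))
    (hyt : yt ∈ prox σ (conj φ) (y + σ • B ((2 : ℝ) • xt - x))) :
    IsPrimalDualStep F' C (fun v => (conj φ v).toReal) {v | conj φ v ≠ ⊤} B τ σ x y xt yt := by
  rw [mem_proj_iff hCc] at hxt
  rw [hφ.conj.mem_prox_iff hσ] at hyt
  refine ⟨hxt.1, hyt.1, fun u hu => ?_, fun v hv => ?_⟩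
  · have h1 := hxt.2 u hu
    have e : x - τ • ((1 / lam) • (x - z)) + τ • B.adjoint (q - y) - xt =
        τ • (τ⁻¹ • (x - xt) - F' x - B.adjoint y) := by
      rw [hF', smul_sub τ (_ - _), smul_sub τ (τ⁻¹ • (x - xt)), smul_inv_smul₀ hτ.ne', map_sub]
      module
    rw [e, inner_smul_left, conj_trivial] at h1
    exact nonpos_of_mul_nonpos_right h1 hτ
  · have h1 := hyt.2 v hv
    have e : σ⁻¹ • (y + σ • B ((2 : ℝ) • xt - x) - yt) =
        σ⁻¹ • (y - yt) + B ((2 : ℝ) • xt - x) := by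
      rw [add_sub_right_comm, smul_add, smul_smul, inv_mul_cancel₀ hσ.ne', one_smul]
    rw [e] at h1
    exact h1

end Main

end StructuredSPF

theorem mainTheorem1 {d n : ℕ}
    (φ : StructuredSPF.E n → EReal) (hφ : StructuredSPF.IsSPF φ)
    (hφc : StructuredSPF.IsConvexFun φ)
    (C : Set (StructuredSPF.E d)) (hC : IsClosed C) (hCc : Convex ℝ C)
    (B : StructuredSPF.E d →L[ℝ] StructuredSPF.E n) (z : StructuredSPF.E d)
    (hfeas : ∃ x ∈ C, φ (B x) ≠ ⊤)
    (lam α τ σ ρ : ℝ) (hlam : 0 < lam) (hα : 0 < α) (hτ : 0 < τ) (hσ : 0 < σ)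
    (hlamα : lam * ‖B‖ ^ 2 < α)
    (hstep : 1 / τ - σ * ‖B‖ ^ 2 > 1 / (2 * lam))
    (hρ : ρ ∈ Set.Ioc (0 : ℝ) 1) :
    (Differentiable ℝ (StructuredSPF.smoothPart φ α lam B z) ∧
      ∀ (x : ℕ → StructuredSPF.E d) (y : ℕ → StructuredSPF.E n),
        StructuredSPF.IsPDRun φ C α lam B z τ σ ρ x y ↔
          StructuredSPF.IsCondatRun (StructuredSPF.smoothPart φ α lam B z)
            (StructuredSPF.indic C) φ B τ σ ρ x y) ∧
    (∀ (x₀ : StructuredSPF.E d) (y₀ : StructuredSPF.E n),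
      ∃ (x : ℕ → StructuredSPF.E d) (y : ℕ → StructuredSPF.E n),
        x 0 = x₀ ∧ y 0 = y₀ ∧ StructuredSPF.IsPDRun φ C α lam B z τ σ ρ x y) ∧
    (∀ (x : ℕ → StructuredSPF.E d) (y : ℕ → StructuredSPF.E n),
      StructuredSPF.IsPDRun φ C α lam B z τ σ ρ x y →
        ∃ xs : StructuredSPF.E d, StructuredSPF.IsSolution φ C α lam B z xs ∧
          Filter.Tendsto x Filter.atTop (nhds xs)) := by

  have hφ' := hφ.isConvexGauge hφc
  have hne : C.Nonempty := let ⟨x, hx, _⟩ := hfeas; ⟨x, hx⟩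
  choose q hq using fun x : StructuredSPF.E d =>
    hφ'.conj.prox_nonempty (inv_pos.2 hα) (α⁻¹ • B x)
  have hF := StructuredSPF.hasQuadraticBounds_smoothPart hφ' hlam hα B z hq
  have hμ : 0 < 1 / lam - ‖B‖ ^ 2 / α := by
    rw [sub_pos, div_lt_div_iff₀ hα hlam]
    linarith
  have hL : 0 < 1 / lam := by positivity
  refine ⟨⟨fun x => (hF.hasGradientAt hμ.le x).differentiableAt, ?_⟩,
    StructuredSPF.exists_isPDRun hφ' hC hCc hne hα hσ, fun x y hxy => ?_⟩
  · refine StructuredSPF.isPDRun_iff_isCondatRun hφ' hne hα hτ fun x q' hq' => ?_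
    rw [(hF.hasGradientAt hμ.le x).gradient, hφ'.conj.prox_unique (inv_pos.2 hα) hq' (hq x)]
  · obtain ⟨xs, hxs, hxst, hmin, hdual⟩ :=
      StructuredSPF.exists_solution_and_dual hφ' hC hCc hfeas hF hμ
    refine ⟨xs, ⟨hxs, fun u hu => ?_⟩, ?_⟩
    · simp only [Set.mem_ofPred_eq, StructuredSPF.objective_eq hφ' hα]
      by_cases hu' : φ (B u) = ⊤
      · rw [hu', EReal.coe_add_top]
        exact le_top
      · rw [← hφ'.coe_toReal hu', ← hφ'.coe_toReal hxst, ← EReal.coe_add, ← EReal.coe_add,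
          EReal.coe_le_coe_iff]
        exact hmin u hu hu'
    · choose xt yt q' hq' hxt hyt hx hy using hxy
      have hstep' : 1 / lam / 2 < 1 / τ - σ * ‖B‖ ^ 2 := by
        rw [div_div, mul_comm lam 2]
        exact hstep
      refine tendsto_of_isPrimalDualStep hF hμ hL hτ hσ hstep' hρ
        (g := fun v => (StructuredSPF.conj φ v).toReal) (D := {v | StructuredSPF.conj φ v ≠ ⊤})
        (C := C) (xt := xt) (y := y) (yt := yt) (fun k => ?_)
        (fun k => by rw [hx k, StructuredSPF.add_smul_sub_eq])
        (fun k => by rw [hy k, StructuredSPF.add_smul_sub_eq]) hxs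
        -- The optimal primal value; weak duality at xs is then the Fenchel-Young inequality.
        (p := StructuredSPF.smoothPart φ α lam B z xs + (φ (B xs)).toReal) (fun v hv => ?_) hdual
      · refine StructuredSPF.isPrimalDualStep_of_mem hφ' hCc hτ hσ (q := q' k) ?_ (hxt k) (hyt k)
        rw [hφ'.conj.prox_unique (inv_pos.2 hα) (hq' k) (hq (x k))]
      · have := hφ'.inner_sub_le_conj hxst hv
        rw [real_inner_comm] at this
        simp only [lagrangian]
        linarith
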